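/- Let $n$ be odd, and let $\Phi=\Phi^+\sqcup(-\Phi^+)\subset\mathbb{R}^n$ be the pseudo-root system of type $D_n$, with positive pseudo-roots $\Phi^+=\{(e_i\pm e_j)/\sqrt2 : 1\le i<j\le n\}$ and Coxeter group $W$ generated by the reflections $s_\alpha$, $\alpha\in\Phi$. For $w\in W$ let $(-1)^w$ be $-1$ to the number of hyperplanes $\alpha^\perp$, $\alpha\in\Phi^+$, separating $w(T_0)$ from the base chamber $T_0=\{x:(\alpha,x)\ge 0 \text{ for all }\alpha\in\Phi^+\}$. A *2-structure* for $\Phi$ is a subset $\varphi\subseteq\Phi$ that is a disjoint union of pairwise orthogonal pseudo-root systems, each of type $A_1$, $B_2$ or $I_2(2^k)$ with $k\ge3$, such that, with $\varphi^+=\varphi\cap\Phi^+$, every $w\in W$ with $w(\varphi^+)=\varphi^+$ has $(-1)^w=1$. Let $\mathcal{T}(\Phi)$ be the set of 2-structures. Each $\varphi\in\mathcal{T}(\Phi)$ is indexed by a maximal matching $M$ of $\{1,\dots,n\}$, in which $i<j$ are joined if and only if the vectors $(\pm e_i\pm e_j)/\sqrt2$ lie in $\varphi$. Its sign is $\epsilon(\varphi)=(-1)^{\mathrm{cross}(M)+p-1}$,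 where $p$ is the isolated vertex of $M$ and $\mathrm{cross}(M)$ is the number of pairs of edges $\{a<b\},\{c<d\}$ of $M$ with $a<c<b<d$. For a set $\psi=\{f_1,\dots,f_k\}$ of $k$ orthogonal unit vectors of $\mathbb{R}^n$ and an integer $d\ge 0$ let $T_d(\psi;a)=T_d((f_1,a),\dots,(f_k,a))$, where $T_d=0$ if $d<k$ or if $d$ and $k$ have opposite parity, and $$T_{2m+k}(x_1,\dots,x_k)=(-1)^m\binom{(n-k)/2}{m}\sum_{r_1+\cdots+r_k=m}\binom{m}{r_1,\dots,r_k}\frac{x_1^{2r_1+1}}{2r_1+1}\cdots\frac{x_k^{2r_k+1}}{2r_k+1}.$$ Define $$Z_d(\Phi;a)=\sum_{\varphi\in\mathcal{T}(\Phi)}\epsilon(\varphi)\,T_d(\varphi^+;a),$$ a polynomial in $a=(a_1,\dots,a_n)$. **Lemma.** For every $d\ge 0$ the polynomial $Z_d(\Phi;a)$ is homogeneous of degree $d$ and satisfies the following. (a) For each $i$ it is invariant under the orthogonal reflection $s_i$ in the coordinate hyperplane $x_i=0$, that is, $Z_d(\Phi;s_i(a))=Z_d(\Phi;a)$. In other words,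 $Z_d(\Phi;a)$ is a polynomial in $a_1^2,\dots,a_n^2$. (b) It contains no monomial $a_1^{\mu_1}\cdots a_n^{\mu_n}$ in which all exponents $\mu_1,\dots,\mu_n$ are positive. (c) It contains no monomial $a_1^{\mu_1}\cdots a_n^{\mu_n}$ in which two of the exponents $\mu_1,\dots,\mu_n$ are equal (exponents equal to $0$ included). -/

import Mathlib

namespace Pizza

open scoped RealInnerProductSpace

noncomputable section

/-- The Euclidean space of dimension `n`. -/
abbrev Space (n : ℕ) : Type := EuclideanSpace ℝ (Fin n)

/-- The standard basis vector `e_i`. -/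
def e {n : ℕ} (i : Fin n) : Space n := EuclideanSpace.single i 1

/-- The orthogonal reflection `s_α` in the hyperplane orthogonal to `α`. -/
def refl {n : ℕ} (α : Space n) : Space n ≃ₗᵢ[ℝ] Space n :=
  (Submodule.span ℝ {α})ᗮ.reflection

/-- The Coxeter group of `Φ`: the group generated by the reflections `s_α`, `α ∈ Φ`. -/
def coxeterGroup {n : ℕ} (Φ : Finset (Space n)) : Subgroup (Space n ≃ₗᵢ[ℝ] Space n) :=
  Subgroup.closure (refl '' (Φ : Set (Space n)))

/-- The base chamber `T₀` attached to the positive pseudo-roots `Φ⁺`. -/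
def baseChamber {n : ℕ} (Φpos : Finset (Space n)) : Set (Space n) :=
  {x | ∀ α ∈ Φpos, 0 ≤ ⟪α, x⟫}

open Classical in
/-- The sign `(-1)^w` of an element `w` of the Coxeter group: `-1` to the number of hyperplanes
`H_α`, `α ∈ Φ⁺`, that separate the chamber `w(T₀)` from the base chamber `T₀`.  As `T₀` lies on
the nonnegative side of `H_α`, this means that `w(T₀)` lies on the nonpositive side. -/
def sign {n : ℕ} (Φpos : Finset (Space n)) (w : Space n ≃ₗᵢ[ℝ] Space n) : ℤ :=
  (-1) ^ (Φpos.filter fun α => ∀ x ∈ baseChamber Φpos, ⟪α, w x⟫ ≤ 0).card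

/-- Pseudo-root systems of type `A₁`: a unit vector and its negative. -/
def IsTypeA1 {n : ℕ} (ψ : Finset (Space n)) : Prop :=
  ∃ α : Space n, ‖α‖ = 1 ∧ (ψ : Set (Space n)) = {α, -α}

/-- Pseudo-root systems of type `I₂(m)`: the `2m` unit vectors at angles `jπ/m`
in some Euclidean plane. -/
def IsTypeI2 {n : ℕ} (m : ℕ) (ψ : Finset (Space n)) : Prop :=
  ∃ u v : Space n, ‖u‖ = 1 ∧ ‖v‖ = 1 ∧ ⟪u, v⟫ = 0 ∧
    (ψ : Set (Space n)) =
      {x | ∃ j : ℕ, j < 2 * m ∧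
        x = Real.cos (j * Real.pi / m) • u + Real.sin (j * Real.pi / m) • v}

open Classical in
/-- `φ` is a 2-structure for the pseudo-root system `Φ` with positive pseudo-roots `Φ⁺`:
(a) `φ` is a disjoint union of pairwise orthogonal pseudo-root systems of type `A₁`, `B₂` or
`I₂(2^k)` with `k ≥ 3` (with unit vectors, `B₂` is `I₂(4)`, so the last two are `I₂(2^k)`, `k ≥ 2`);
(b) every `w` in the Coxeter group of `Φ` with `w(φ⁺) = φ⁺` has sign `1`, where `φ⁺ = φ ∩ Φ⁺`. -/
structure IsTwoStructure {n : ℕ} (Φ Φpos φ : Finset (Space n)) : Prop where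
  subset : φ ⊆ Φ
  decomposition : ∃ (r : ℕ) (c : Fin r → Finset (Space n)),
    (φ : Set (Space n)) = ⋃ t, (c t : Set (Space n)) ∧
    (∀ s t, s ≠ t → Disjoint (c s) (c t)) ∧
    (∀ s t, s ≠ t → ∀ α ∈ c s, ∀ β ∈ c t, ⟪α, β⟫ = 0) ∧
    ∀ t, IsTypeA1 (c t) ∨ ∃ k : ℕ, 2 ≤ k ∧ IsTypeI2 (2 ^ k) (c t)
  sign_eq_one : ∀ w ∈ coxeterGroup Φ,
    w '' ((φ ∩ Φpos : Finset (Space n)) : Set (Space n)) =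
      ((φ ∩ Φpos : Finset (Space n)) : Set (Space n)) →
    sign Φpos w = 1

open Classical in
/-- The finite set `𝒯(Φ)` of 2-structures for `Φ`. -/
def twoStructures {n : ℕ} (Φ Φpos : Finset (Space n)) : Finset (Finset (Space n)) :=
  Φ.powerset.filter fun φ => IsTwoStructure Φ Φpos φ

/-- `(e_i + e_j)/√2`. -/
def rootPlus {n : ℕ} (i j : Fin n) : Space n := (√2)⁻¹ • (e i + e j)

/-- `(e_i - e_j)/√2`. -/
def rootMinus {n : ℕ} (i j : Fin n) : Space n := (√2)⁻¹ • (e i - e j)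

open Classical in
/-- The positive pseudo-roots `(e_i ± e_j)/√2`, `i < j`, of type `D_n`. -/
def posRootsD (n : ℕ) : Finset (Space n) :=
  ((Finset.univ.filter fun q : Fin n × Fin n => q.1 < q.2).image fun q => rootPlus q.1 q.2) ∪
  ((Finset.univ.filter fun q : Fin n × Fin n => q.1 < q.2).image fun q => rootMinus q.1 q.2)

open Classical in
/-- The pseudo-root system of type `D_n`. -/
def rootsD (n : ℕ) : Finset (Space n) :=
  posRootsD n ∪ (posRootsD n).image fun α => -α

open Classical in
/-- The matching on the vertex set `Fin n` that indexes a 2-structure `φ` of type `D_n`: `i < j`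
are joined if and only if the vectors `(e_i ± e_j)/√2` lie in `φ`. -/
def matchingOf {n : ℕ} (φ : Finset (Space n)) : Finset (Fin n × Fin n) :=
  Finset.univ.filter fun q => q.1 < q.2 ∧ rootPlus q.1 q.2 ∈ φ ∧ rootMinus q.1 q.2 ∈ φ

/-- The number of crossings `a < c < b < d` of edges `{a < b}`, `{c < d}` of a matching. -/
def crossings {n : ℕ} (M : Finset (Fin n × Fin n)) : ℕ :=
  ((M ×ˢ M).filter fun q => q.1.1 < q.2.1 ∧ q.2.1 < q.1.2 ∧ q.1.2 < q.2.2).card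

/-- The vertices that lie on no edge of a matching. -/
def isolated {n : ℕ} (M : Finset (Fin n × Fin n)) : Finset (Fin n) :=
  Finset.univ.filter fun p => ∀ q ∈ M, q.1 ≠ p ∧ q.2 ≠ p

/-- The sign `(-1)^M` of a maximal matching `M` on `n` vertices.  For even `n` there is no isolated
vertex and the exponent is the number of crossings; for odd `n` there is one, the vertex `p` in the
numbering `1, …, n`, and the exponent is the number of crossings plus `p - 1`, where `p - 1` is the
value of this vertex as an element of `Fin n`. -/
def matchingSign {n : ℕ} (M : Finset (Fin n × Fin n)) : ℤ :=
  (-1) ^ (crossings M + ∑ p ∈ isolated M, (p : ℕ))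

/-- The sign `ε(φ)` of a 2-structure of type `D_n`. -/
def epsilonD {n : ℕ} (φ : Finset (Space n)) : ℤ := matchingSign (matchingOf φ)

/-- The coefficient `c_m = (-1)^m * binom((n-k)/2, m)`. -/
def taylorCoeff (n k m : ℕ) : ℝ :=
  (-1) ^ m * ((∏ j ∈ Finset.range m, (((n : ℝ) - k) / 2 - j)) / (Nat.factorial m : ℝ))

open Classical in
/-- The polynomial `T_d` in `k` variables indexed by a finite type `ι` with `k` elements, for an
ambient space of dimension `n`; it is zero if `d < k` or if `d` and `k` differ in parity, and
otherwise `d = 2m + k`. -/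
def taylorPoly (n d : ℕ) (ι : Type) [Fintype ι] : MvPolynomial ι ℝ :=
  if Fintype.card ι ≤ d ∧ Even (d - Fintype.card ι) then
    MvPolynomial.C (taylorCoeff n (Fintype.card ι) ((d - Fintype.card ι) / 2)) *
      ∑ r ∈ Finset.piAntidiag (Finset.univ : Finset ι) ((d - Fintype.card ι) / 2),
        MvPolynomial.C (Nat.multinomial Finset.univ r : ℝ) *
          ∏ i, MvPolynomial.C (1 / (2 * (r i : ℝ) + 1)) * MvPolynomial.X i ^ (2 * r i + 1)
  else 0

/-- The linear form `(f, a)` as a polynomial in the coordinates `a_1, …, a_n` of `a`. -/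
def linForm {n : ℕ} (f : Space n) : MvPolynomial (Fin n) ℝ :=
  ∑ i, MvPolynomial.C (f i) * MvPolynomial.X i

/-- `T_d(ψ; a) = T_d((f_1, a), …, (f_k, a))` for `ψ = {f_1, …, f_k}`, as a polynomial in `a`.
Since `T_d` is symmetric, its variables may be indexed by the set `ψ` itself. -/
def taylorPolySet {n : ℕ} (d : ℕ) (ψ : Finset (Space n)) : MvPolynomial (Fin n) ℝ :=
  MvPolynomial.aeval (fun f : ψ => linForm (f : Space n)) (taylorPoly n d ψ)

open Classical in
/-- `Z_d(Φ; a) = ∑_φ ε(φ) * T_d(φ⁺; a)` for `Φ` of type `D_n`, the sum over all 2-structures `φ`,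
as a polynomial in the coordinates of `a`. -/
def ZD (n d : ℕ) : MvPolynomial (Fin n) ℝ :=
  ∑ φ ∈ twoStructures (rootsD n) (posRootsD n),
    MvPolynomial.C (epsilonD φ : ℝ) * taylorPolySet d (φ ∩ posRootsD n)

end

end Pizza

/-!
For odd `n`, the 2-structures of type `D_n` are exactly the sets of vectors `(± e_i ± e_j)/√2`,
where `{i, j}` runs over the edges of a near-perfect matching of the `n` coordinates
(`IsTwoStructure.exists_eq_structureOf`, `isTwoStructure_structureOf`).  Such a matching is encoded
as an involution `f` with one fixed point.

* A 2-structure consists of pairwise orthogonal pairs `±α`, since the inner products of pseudo-roots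
  exclude `I₂(2^k)`, `k ≥ 2`, and it is maximal with this property, since the reflection in a
  pseudo-root orthogonal to it would fix it and has sign `-1`.  Maximality forces both
  `e_i + e_j` and `e_i - e_j` to occur together, and at most one coordinate to be left over.
* Conversely, elements of the Coxeter group are signed permutations, and the sign of a signed
  permutation is the sign of the underlying permutation `π` (`IsSignedPerm.sign_eq`).  If it
  preserves the positive part of the structure, then `π` permutes the edges and maps smaller ends to
  smaller ends, so `π` acts on smaller and on larger ends in the same way and is even.

Hence `Z_d` is a sum over near-perfect matchings (`ZD_eq_sum`), and the summand of a matching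
is, up to its sign, a combination of products over the edges `{i < j}` of odd powers of
`a_i + a_j` and of `a_i - a_j`, symmetric in all these linear forms and odd in each of them.

* Replacing `a_i` by `-a_i` exchanges the two linear forms of the edge at `i` up to a common sign,
  so every summand is even in every variable (`flip_matchingPoly`).
* A summand does not involve the variable of the isolated vertex
  (`matchingPoly_mem_supported`), which excludes monomials with all exponents positive.
* The sum is alternating (`rename_ZD`).  It suffices to exchange two adjacent variables `a_k` and
  `a_{k+1}`.  If `k` and `k + 1` are joined, the summand changes sign with the factor
  `a_k - a_{k+1}`; if not, it goes to the summand of the matching conjugated by the transposition,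
  which has the opposite sign (`epsilonD_structureOf_conj`).  A monomial with two equal exponents is
  fixed by a transposition of the variables, so it cannot occur in an alternating polynomial.
-/

namespace Pizza

open scoped RealInnerProductSpace

noncomputable section

variable {n : ℕ}

/-! ### Roots of type `D` -/

/-- The vector `(s e_i + t e_j)/√2` for signs `s` and `t`.  For `i ≠ j` these are the pseudo-roots
of type `D`, each of them written in two ways, since `(s, i)` and `(t, j)` can be exchanged. -/
def signedRoot (s t : ℤˣ) (i j : Fin n) : Space n :=
  (√2)⁻¹ • (((s : ℤ) : ℝ) • e i + ((t : ℤ) : ℝ) • e j)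

lemma signedRoot_apply (s t : ℤˣ) (i j k : Fin n) :
    signedRoot s t i j k =
      (√2)⁻¹ * ((if k = i then ((s : ℤ) : ℝ) else 0) + if k = j then ((t : ℤ) : ℝ) else 0) := by
  simp [signedRoot, e, mul_add]

lemma signedRoot_comm (s t : ℤˣ) (i j : Fin n) : signedRoot s t i j = signedRoot t s j i := by
  simp [signedRoot, add_comm]

lemma neg_signedRoot (s t : ℤˣ) (i j : Fin n) :
    -signedRoot s t i j = signedRoot (-s) (-t) i j := by
  ext k
  simp only [PiLp.neg_apply, signedRoot_apply, Units.val_neg, Int.cast_neg]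
  split_ifs <;> ring

lemma rootPlus_eq (i j : Fin n) : rootPlus i j = signedRoot 1 1 i j := by
  simp [rootPlus, signedRoot]

lemma rootMinus_eq (i j : Fin n) : rootMinus i j = signedRoot 1 (-1) i j := by
  simp [rootMinus, signedRoot, sub_eq_add_neg]

lemma inner_signedRoot (s t : ℤˣ) (i j : Fin n) (x : Space n) :
    ⟪signedRoot s t i j, x⟫ = (√2)⁻¹ * (((s : ℤ) : ℝ) * x i + ((t : ℤ) : ℝ) * x j) := by
  simp [signedRoot, e, inner_smul_left, inner_add_left, EuclideanSpace.inner_single_left, mul_add]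

lemma inv_sqrt_two_sq : (√2 : ℝ)⁻¹ * (√2)⁻¹ = 1 / 2 := by
  rw [← mul_inv, Real.mul_self_sqrt (by norm_num)]
  norm_num

lemma inv_sqrt_two_pos : 0 < (√2 : ℝ)⁻¹ := by positivity

lemma inner_signedRoot_signedRoot (s t s' t' : ℤˣ) (i j i' j' : Fin n) :
    ⟪signedRoot s t i j, signedRoot s' t' i' j'⟫ =
      1 / 2 * (((s : ℤ) : ℝ) *
          ((if i = i' then ((s' : ℤ) : ℝ) else 0) + if i = j' then ((t' : ℤ) : ℝ) else 0) +
        ((t : ℤ) : ℝ) *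
          ((if j = i' then ((s' : ℤ) : ℝ) else 0) + if j = j' then ((t' : ℤ) : ℝ) else 0)) := by
  rw [inner_signedRoot, signedRoot_apply, signedRoot_apply, ← inv_sqrt_two_sq]
  ring

lemma norm_signedRoot (s t : ℤˣ) {i j : Fin n} (hij : i ≠ j) : ‖signedRoot s t i j‖ = 1 := by
  have h : ‖signedRoot s t i j‖ ^ 2 = 1 := by
    rw [← real_inner_self_eq_norm_sq, inner_signedRoot_signedRoot]
    rcases Int.units_eq_one_or s with rfl | rfl <;> rcases Int.units_eq_one_or t with rfl | rfl <;>
      simp [hij, hij.symm] <;> norm_num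
  exact (pow_eq_one_iff_of_nonneg (norm_nonneg _) two_ne_zero).1 h

lemma signedRoot_eq_iff {s t s' t' : ℤˣ} {i j i' j' : Fin n} (hij : i ≠ j) (hij' : i' ≠ j') :
    signedRoot s t i j = signedRoot s' t' i' j' ↔
      (i = i' ∧ j = j' ∧ s = s' ∧ t = t') ∨ (i = j' ∧ j = i' ∧ s = t' ∧ t = s') := by
  constructor
  · intro h
    have hi := congrArg (fun x : Space n => x i) h
    have hj := congrArg (fun x : Space n => x j) h
    have hu : ∀ u : ℤˣ, ((u : ℤ) : ℝ) ≠ 0 := fun u => by exact_mod_cast u.ne_zero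
    have hinj : ∀ u v : ℤˣ, ((u : ℤ) : ℝ) = ((v : ℤ) : ℝ) → u = v := fun u v huv =>
      Units.ext (by exact_mod_cast huv)
    simp only [signedRoot_apply, mul_right_inj' inv_sqrt_two_pos.ne', if_true, if_neg hij,
      if_neg hij.symm, add_zero, zero_add] at hi hj
    by_cases h1 : i = i'
    · subst h1
      rw [if_pos rfl, if_neg hij', add_zero] at hi
      rw [if_neg hij.symm, zero_add] at hj
      split_ifs at hj with h2
      · exact Or.inl ⟨rfl, h2, hinj _ _ hi, hinj _ _ hj⟩
      · exact (hu _ hj).elim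
    · rw [if_neg h1, zero_add] at hi
      split_ifs at hi with h2
      · subst h2
        rw [if_neg hij.symm, add_zero] at hj
        split_ifs at hj with h3
        · exact Or.inr ⟨rfl, h3, hinj _ _ hi, hinj _ _ hj⟩
        · exact (hu _ hj).elim
      · exact (hu _ hi).elim
  · rintro (⟨rfl, rfl, rfl, rfl⟩ | ⟨rfl, rfl, rfl, rfl⟩)
    · rfl
    · exact signedRoot_comm _ _ _ _

lemma mem_posRootsD {x : Space n} :
    x ∈ posRootsD n ↔ ∃ i j : Fin n, ∃ t : ℤˣ, i < j ∧ signedRoot 1 t i j = x := by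
  simp only [posRootsD, Finset.mem_union, Finset.mem_image, Finset.mem_filter, Finset.mem_univ,
    true_and, Prod.exists, rootPlus_eq, rootMinus_eq]
  constructor
  · rintro (⟨i, j, h, rfl⟩ | ⟨i, j, h, rfl⟩)
    exacts [⟨i, j, 1, h, rfl⟩, ⟨i, j, -1, h, rfl⟩]
  · rintro ⟨i, j, t, h, rfl⟩
    rcases Int.units_eq_one_or t with rfl | rfl
    exacts [Or.inl ⟨i, j, h, rfl⟩, Or.inr ⟨i, j, h, rfl⟩]

lemma mem_rootsD {x : Space n} :
    x ∈ rootsD n ↔ ∃ i j : Fin n, ∃ s t : ℤˣ, i ≠ j ∧ signedRoot s t i j = x := by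
  simp only [rootsD, Finset.mem_union, Finset.mem_image, mem_posRootsD]
  constructor
  · rintro (⟨i, j, t, h, rfl⟩ | ⟨_, ⟨i, j, t, h, rfl⟩, rfl⟩)
    exacts [⟨i, j, 1, t, h.ne, rfl⟩, ⟨i, j, -1, -t, h.ne, (neg_signedRoot _ _ _ _).symm⟩]
  · rintro ⟨i, j, s, t, h, rfl⟩
    wlog hlt : i < j generalizing i j s t
    · rw [signedRoot_comm]
      exact this j i t s h.symm (lt_of_le_of_ne (not_lt.1 hlt) h.symm)
    rcases Int.units_eq_one_or s with rfl | rfl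
    · exact Or.inl ⟨i, j, t, hlt, rfl⟩
    · exact Or.inr ⟨_, ⟨i, j, -t, hlt, rfl⟩, by rw [neg_signedRoot, neg_neg]⟩

lemma signedRoot_mem_posRootsD {s t : ℤˣ} {i j : Fin n} (hij : i < j) :
    signedRoot s t i j ∈ posRootsD n ↔ s = 1 := by
  rw [mem_posRootsD]
  constructor
  · rintro ⟨i', j', t', hij', h⟩
    rcases (signedRoot_eq_iff hij'.ne hij.ne).1 h with ⟨-, -, rfl, -⟩ | ⟨rfl, rfl, -, -⟩
    · rfl
    · exact absurd hij' hij.asymm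
  · rintro rfl
    exact ⟨i, j, t, hij, rfl⟩

/-- Inner products of pseudo-roots of type `D` are multiples of `1 / 2`. -/
lemma inner_rootsD {x y : Space n} (hx : x ∈ rootsD n) (hy : y ∈ rootsD n) :
    ∃ z : ℤ, ⟪x, y⟫ = z / 2 := by
  obtain ⟨i, j, s, t, -, rfl⟩ := mem_rootsD.1 hx
  obtain ⟨i', j', s', t', -, rfl⟩ := mem_rootsD.1 hy
  refine ⟨(s : ℤ) * ((if i = i' then (s' : ℤ) else 0) + if i = j' then (t' : ℤ) else 0) +
        (t : ℤ) * ((if j = i' then (s' : ℤ) else 0) + if j = j' then (t' : ℤ) else 0), ?_⟩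
  rw [inner_signedRoot_signedRoot]
  push_cast
  ring

/-! ### Signed permutations -/

/-- The isometry `w` permutes the coordinates by `π` and multiplies them by the signs `s`: the
`i`-th coordinate of `w x` is `s i` times the `π i`-th coordinate of `x`. -/
def IsSignedPerm (w : Space n ≃ₗᵢ[ℝ] Space n) (π : Equiv.Perm (Fin n)) (s : Fin n → ℤˣ) : Prop :=
  ∀ x i, w x i = ((s i : ℤ) : ℝ) * x (π i)

lemma IsSignedPerm.one : IsSignedPerm (1 : Space n ≃ₗᵢ[ℝ] Space n) 1 1 := by
  intro x i
  simp

lemma IsSignedPerm.mul {w w' : Space n ≃ₗᵢ[ℝ] Space n} {π π' : Equiv.Perm (Fin n)}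
    {s s' : Fin n → ℤˣ} (h : IsSignedPerm w π s) (h' : IsSignedPerm w' π' s') :
    IsSignedPerm (w * w') (π' * π) (fun i => s i * s' (π i)) := by
  intro x i
  have : (w * w') x = w (w' x) := rfl
  rw [this, h, h']
  simp [mul_assoc]

lemma IsSignedPerm.inv {w : Space n ≃ₗᵢ[ℝ] Space n} {π : Equiv.Perm (Fin n)}
    {s : Fin n → ℤˣ} (h : IsSignedPerm w π s) :
    IsSignedPerm w⁻¹ π⁻¹ (fun i => s (π⁻¹ i)) := by
  intro x i
  have hx : w (w⁻¹ x) = x := w.apply_symm_apply x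
  have := h (w⁻¹ x) (π⁻¹ i)
  rw [hx] at this
  rw [this, ← mul_assoc]
  simp [← Int.cast_mul]

lemma IsSignedPerm.apply_signedRoot {w : Space n ≃ₗᵢ[ℝ] Space n} {π : Equiv.Perm (Fin n)}
    {s : Fin n → ℤˣ} (h : IsSignedPerm w π s) (u v : ℤˣ) (i j : Fin n) :
    w (signedRoot u v (π i) (π j)) = signedRoot (s i * u) (s j * v) i j := by
  ext k
  rw [h, signedRoot_apply, signedRoot_apply]
  simp only [π.injective.eq_iff]
  by_cases h1 : k = i
  · subst h1
    by_cases h2 : k = j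
    · subst h2
      simp
      ring
    · simp [h2]
      ring
  · by_cases h2 : k = j
    · subst h2
      simp [h1]
      ring
    · simp [h1, h2]

lemma refl_signedRoot_apply (s t : ℤˣ) {i j : Fin n} (hij : i ≠ j) (x : Space n) :
    refl (signedRoot s t i j) x =
      x - (2 * ⟪signedRoot s t i j, x⟫) • signedRoot s t i j := by
  rw [refl, Submodule.reflection_orthogonal_apply, Submodule.reflection_singleton_apply,
    norm_signedRoot s t hij]
  simp [two_smul, two_mul, add_smul]

lemma IsSignedPerm.refl_signedRoot (s t : ℤˣ) {i j : Fin n} (hij : i ≠ j) :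
    IsSignedPerm (refl (signedRoot s t i j)) (Equiv.swap i j)
      (fun k => if k = i ∨ k = j then -(s * t) else 1) := by
  intro x k
  rw [refl_signedRoot_apply s t hij, PiLp.sub_apply, PiLp.smul_apply, signedRoot_apply,
    inner_signedRoot, smul_eq_mul]
  have h2 : ∀ y z : ℝ, 2 * ((√2)⁻¹ * y) * ((√2)⁻¹ * z) = y * z := fun y z => by
    linear_combination 2 * y * z * inv_sqrt_two_sq
  rw [h2]
  by_cases h1 : k = i
  · subst h1
    rcases Int.units_eq_one_or s with rfl | rfl <;> rcases Int.units_eq_one_or t with rfl | rfl <;>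
      simp [hij]
  · by_cases h3 : k = j
    · subst h3
      rcases Int.units_eq_one_or s with rfl | rfl <;>
        rcases Int.units_eq_one_or t with rfl | rfl <;> simp [hij.symm]
    · simp [h1, h3, Equiv.swap_apply_of_ne_of_ne]

lemma exists_isSignedPerm {w : Space n ≃ₗᵢ[ℝ] Space n} (hw : w ∈ coxeterGroup (rootsD n)) :
    ∃ π s, IsSignedPerm w π s := by
  induction hw using Subgroup.closure_induction with
  | mem w hw =>
    obtain ⟨α, hα, rfl⟩ := hw
    obtain ⟨i, j, s, t, hij, rfl⟩ := mem_rootsD.1 hα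
    exact ⟨_, _, IsSignedPerm.refl_signedRoot s t hij⟩
  | one => exact ⟨_, _, IsSignedPerm.one⟩
  | mul w w' _ _ h h' =>
    obtain ⟨π, s, h⟩ := h
    obtain ⟨π', s', h'⟩ := h'
    exact ⟨_, _, h.mul h'⟩
  | inv w _ h =>
    obtain ⟨π, s, h⟩ := h
    exact ⟨_, _, h.inv⟩

lemma mem_baseChamber {x : Space n} :
    x ∈ baseChamber (posRootsD n) ↔ ∀ i j, i < j → |x j| ≤ x i := by
  constructor
  · intro hx i j hij
    have h1 := hx _ (mem_posRootsD.2 ⟨i, j, 1, hij, rfl⟩)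
    have h2 := hx _ (mem_posRootsD.2 ⟨i, j, -1, hij, rfl⟩)
    rw [inner_signedRoot, mul_nonneg_iff_of_pos_left inv_sqrt_two_pos] at h1 h2
    simp only [Units.val_one, Int.cast_one, one_mul, Units.val_neg, Int.cast_neg, neg_mul]
      at h1 h2
    rw [abs_le]
    constructor <;> linarith
  · intro hx α hα
    obtain ⟨i, j, t, hij, rfl⟩ := mem_posRootsD.1 hα
    have h := abs_le.1 (hx i j hij)
    rw [inner_signedRoot, mul_nonneg_iff_of_pos_left inv_sqrt_two_pos]
    rcases Int.units_eq_one_or t with rfl | rfl <;> simp <;> linarith [h.1, h.2]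

/-- A pseudo-root is nonpositive on the base chamber if and only if its first coefficient is
negative, because `x_i > |x_j|` for `i < j` in the interior of the chamber. -/
lemma forall_baseChamber_nonpos (s t : ℤˣ) {i j : Fin n} (hij : i < j) :
    (∀ x ∈ baseChamber (posRootsD n), ((s : ℤ) : ℝ) * x i + ((t : ℤ) : ℝ) * x j ≤ 0) ↔
      s = -1 := by
  constructor
  · intro h
    -- the point `(n, n - 1, …, 1)` lies in the interior of the chamber
    have h := h (WithLp.toLp 2 fun k : Fin n => (n : ℝ) - (k : ℕ))
      (mem_baseChamber.2 fun a b hab => by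
        have h1 : ((a : ℕ) : ℝ) < (b : ℕ) := by exact_mod_cast hab
        have h2 : ((b : ℕ) : ℝ) < n := by exact_mod_cast b.2
        simp only []
        rw [abs_of_pos] <;> linarith)
    have h1 : ((i : ℕ) : ℝ) < (j : ℕ) := by exact_mod_cast hij
    have h2 : ((j : ℕ) : ℝ) < n := by exact_mod_cast j.2
    rcases Int.units_eq_one_or s with rfl | rfl
    · exfalso
      rcases Int.units_eq_one_or t with rfl | rfl <;>
        simp only [Units.val_one, Units.val_neg, Int.cast_one, Int.cast_neg] at h <;> linarith
    · rfl
  · rintro rfl x hx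
    have h := abs_le.1 (mem_baseChamber.1 hx i j hij)
    rcases Int.units_eq_one_or t with rfl | rfl <;> simp <;> linarith [h.1, h.2]

lemma prod_posRootsD (F : Space n → ℤ) :
    ∏ α ∈ posRootsD n, F α =
      ∏ i : Fin n, ∏ j ∈ Finset.Ioi i, F (signedRoot 1 1 i j) * F (signedRoot 1 (-1) i j) := by
  classical
  have hinj : ∀ t : ℤˣ, Set.InjOn (fun q : Fin n × Fin n => signedRoot 1 t q.1 q.2)
      ((Finset.univ.filter fun q : Fin n × Fin n => q.1 < q.2 : Finset _) : Set _) := by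
    rintro t ⟨i, j⟩ hij ⟨i', j'⟩ hij' heq
    simp only [Finset.coe_filter, Finset.mem_univ, true_and, Set.mem_ofPred_eq] at hij hij'
    rcases (signedRoot_eq_iff hij.ne hij'.ne).1 heq with ⟨rfl, rfl, -⟩ | ⟨rfl, rfl, -⟩
    · rfl
    · exact absurd hij hij'.asymm
  have hdisj : Disjoint
      ((Finset.univ.filter fun q : Fin n × Fin n => q.1 < q.2).image
        fun q => signedRoot 1 1 q.1 q.2)
      ((Finset.univ.filter fun q : Fin n × Fin n => q.1 < q.2).image
        fun q => signedRoot 1 (-1) q.1 q.2) := by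
    rw [Finset.disjoint_left]
    intro x hx hx'
    simp only [Finset.mem_image, Finset.mem_filter, Finset.mem_univ, true_and] at hx hx'
    obtain ⟨⟨i, j⟩, hij, rfl⟩ := hx
    obtain ⟨⟨i', j'⟩, hij', heq⟩ := hx'
    rcases (signedRoot_eq_iff hij'.ne hij.ne).1 heq with ⟨-, -, -, h⟩ | ⟨rfl, rfl, -⟩
    · exact absurd h (by decide)
    · exact absurd hij hij'.asymm
  have hunion : posRootsD n =
      ((Finset.univ.filter fun q : Fin n × Fin n => q.1 < q.2).image
        fun q => signedRoot 1 1 q.1 q.2) ∪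
      ((Finset.univ.filter fun q : Fin n × Fin n => q.1 < q.2).image
        fun q => signedRoot 1 (-1) q.1 q.2) := by
    simp only [← rootPlus_eq, ← rootMinus_eq]
    unfold posRootsD
    congr!
  rw [hunion, Finset.prod_union hdisj, Finset.prod_image (hinj 1), Finset.prod_image (hinj (-1)),
    ← Finset.prod_mul_distrib, Finset.prod_sigma']
  refine Finset.prod_nbij' (fun q => ⟨q.1, q.2⟩) (fun q => (q.1, q.2)) ?_ ?_ ?_ ?_ ?_ <;> simp

/-- The sign of a signed permutation in the sense of separating hyperplanes is the sign of the
underlying permutation: for `i < j`, the hyperplanes of `e_i + e_j` and `e_i - e_j` both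
separate or both do not if `π i < π j`, and exactly one of them separates if `π j < π i`. -/
lemma IsSignedPerm.sign_eq {w : Space n ≃ₗᵢ[ℝ] Space n} {π : Equiv.Perm (Fin n)}
    {s : Fin n → ℤˣ} (h : IsSignedPerm w π s) :
    sign (posRootsD n) w = Equiv.Perm.sign π := by
  classical
  have key : ∀ (t : ℤˣ) (i j : Fin n), i < j →
      ((∀ x ∈ baseChamber (posRootsD n), ⟪signedRoot 1 t i j, w x⟫ ≤ 0) ↔
        (if π i < π j then s i else t * s j) = -1) := by
    intro t i j hij
    have h1 : ∀ x : Space n, ⟪signedRoot 1 t i j, w x⟫ ≤ 0 ↔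
        ((s i : ℤ) : ℝ) * x (π i) + (((t * s j : ℤˣ) : ℤ) : ℝ) * x (π j) ≤ 0 := by
      intro x
      rw [inner_signedRoot, mul_nonpos_iff_pos_imp_nonpos]
      simp [inv_sqrt_two_pos.le, h x, mul_assoc]
    simp only [h1]
    split_ifs with h2
    · exact forall_baseChamber_nonpos _ _ h2
    · have h3 : π j < π i := lt_of_le_of_ne (not_lt.1 h2) (π.injective.ne hij.ne')
      simp only [add_comm (((s i : ℤ) : ℝ) * _)]
      exact forall_baseChamber_nonpos _ _ h3
  have hpair : ∀ i j : Fin n, i < j →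
      ((if ∀ x ∈ baseChamber (posRootsD n), ⟪signedRoot 1 1 i j, w x⟫ ≤ 0 then (-1 : ℤ) else 1) *
        if ∀ x ∈ baseChamber (posRootsD n), ⟪signedRoot 1 (-1) i j, w x⟫ ≤ 0 then (-1 : ℤ)
          else 1) =
      ((if π i < π j then 1 else -1 : ℤˣ) : ℤ) := by
    intro i j hij
    simp only [key _ i j hij]
    rcases Int.units_eq_one_or (s i) with hi | hi <;>
      rcases Int.units_eq_one_or (s j) with hj | hj <;> by_cases hlt : π i < π j <;>
      simp [hi, hj, hlt]
  have hprod : sign (posRootsD n) w = ∏ α ∈ posRootsD n,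
      if ∀ x ∈ baseChamber (posRootsD n), ⟪α, w x⟫ ≤ 0 then (-1 : ℤ) else 1 := by
    rw [sign, Finset.prod_ite, Finset.prod_const, Finset.prod_const_one, mul_one]
  rw [hprod, prod_posRootsD, Equiv.Perm.sign_eq_prod_prod_Ioi, Units.coe_prod]
  refine Finset.prod_congr rfl fun i _ => ?_
  rw [Units.coe_prod]
  exact Finset.prod_congr rfl fun j hj => hpair i j (Finset.mem_Ioi.1 hj)

/-! ### The 2-structures of type `D` and near-perfect matchings -/

/-- A near-perfect matching of `{0, …, n - 1}`, encoded as the involution that exchanges the two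
ends of every edge and fixes the isolated vertex. -/
structure IsNearPerfect (f : Equiv.Perm (Fin n)) : Prop where
  apply_apply : ∀ i, f (f i) = i
  existsUnique_fixed : ∃! p, f p = p

open Classical in
/-- The set of the vectors `(± e_i ± e_j)/√2` for the edges `{i, j}` of the matching given by the
involution `f`. -/
def structureOf (f : Equiv.Perm (Fin n)) : Finset (Space n) :=
  (Finset.univ.filter fun q : Fin n × ℤˣ × ℤˣ => f q.1 ≠ q.1).image
    fun q => signedRoot q.2.1 q.2.2 q.1 (f q.1)

lemma mem_structureOf {f : Equiv.Perm (Fin n)} {x : Space n} :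
    x ∈ structureOf f ↔ ∃ i s t, f i ≠ i ∧ signedRoot s t i (f i) = x := by
  simp only [structureOf, Finset.mem_image, Finset.mem_filter, Finset.mem_univ, true_and,
    Prod.exists]

lemma signedRoot_mem_structureOf {f : Equiv.Perm (Fin n)} (hf : IsNearPerfect f) (s t : ℤˣ)
    {i j : Fin n} (hij : i ≠ j) : signedRoot s t i j ∈ structureOf f ↔ f i = j := by
  rw [mem_structureOf]
  constructor
  · rintro ⟨k, s', t', hk, h⟩
    rcases (signedRoot_eq_iff hk.symm hij).1 h with ⟨rfl, h, -⟩ | ⟨rfl, rfl, -⟩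
    · exact h
    · exact hf.apply_apply _
  · rintro rfl
    exact ⟨i, s, t, hij.symm, rfl⟩

lemma mem_structureOf_inter_posRootsD {f : Equiv.Perm (Fin n)} (hf : IsNearPerfect f)
    {x : Space n} :
    x ∈ structureOf f ∧ x ∈ posRootsD n ↔ ∃ i t, i < f i ∧ signedRoot 1 t i (f i) = x := by
  constructor
  · rintro ⟨h, hpos⟩
    obtain ⟨i, j, t, hij, rfl⟩ := mem_posRootsD.1 hpos
    have := (signedRoot_mem_structureOf hf _ _ hij.ne).1 h
    subst this
    exact ⟨i, t, hij, rfl⟩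
  · rintro ⟨i, t, hi, rfl⟩
    exact ⟨(signedRoot_mem_structureOf hf _ _ hi.ne).2 rfl, (signedRoot_mem_posRootsD hi).2 rfl⟩

/-- Pseudo-root systems of type `I₂(2^k)` with `k ≥ 2` contain two vectors whose inner product
`cos (π / 2^k)` lies strictly between `1 / 2` and `1`. -/
lemma not_isTypeI2 {ψ : Finset (Space n)} (hψ : ψ ⊆ rootsD n) {k : ℕ} (hk : 2 ≤ k) :
    ¬ IsTypeI2 (2 ^ k) ψ := by
  rintro ⟨u, v, hu, -, huv, h⟩
  have hm : 4 ≤ 2 ^ k := (Nat.pow_le_pow_right two_pos hk : 2 ^ 2 ≤ 2 ^ k)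
  have hm' : (4 : ℝ) ≤ ((2 ^ k : ℕ) : ℝ) := by exact_mod_cast hm
  have hu' : u ∈ (ψ : Set (Space n)) := by
    rw [h]
    exact ⟨0, by omega, by simp⟩
  have hx : Real.cos (Real.pi / (2 ^ k : ℕ)) • u + Real.sin (Real.pi / (2 ^ k : ℕ)) • v ∈
      (ψ : Set (Space n)) := by
    rw [h]
    exact ⟨1, by omega, by simp⟩
  obtain ⟨z, hz⟩ := inner_rootsD (hψ hu') (hψ hx)
  rw [inner_add_right, inner_smul_right, inner_smul_right, huv, real_inner_self_eq_norm_sq, hu]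
    at hz
  have hpi := Real.pi_pos
  have h1 : Real.cos (Real.pi / (2 ^ k : ℕ)) < 1 := by
    rw [← Real.cos_zero]
    refine Real.cos_lt_cos_of_nonneg_of_le_pi le_rfl ?_ (by positivity)
    rw [div_le_iff₀ (by linarith)]
    nlinarith
  have h2 : 1 / 2 < Real.cos (Real.pi / (2 ^ k : ℕ)) := by
    rw [← Real.cos_pi_div_three]
    refine Real.cos_lt_cos_of_nonneg_of_le_pi (by positivity) (by linarith) ?_
    exact div_lt_div_of_pos_left hpi (by norm_num) (by linarith)
  have h3 : (1 : ℝ) < z := by linarith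
  have h4 : (z : ℝ) < 2 := by linarith
  norm_cast at h3 h4
  omega

namespace IsTwoStructure

variable {φ : Finset (Space n)}

lemma neg_mem_and_orthogonal (h : IsTwoStructure (rootsD n) (posRootsD n) φ) :
    (∀ α ∈ φ, -α ∈ φ) ∧ ∀ α ∈ φ, ∀ β ∈ φ, β = α ∨ β = -α ∨ ⟪α, β⟫ = 0 := by
  obtain ⟨r, c, hφ, -, horth, htype⟩ := h.decomposition
  have hc : ∀ t, c t ⊆ φ := fun t x hx => by
    rw [← Finset.mem_coe, hφ]
    exact Set.mem_iUnion.2 ⟨t, hx⟩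
  have hA1 : ∀ t, IsTypeA1 (c t) := fun t =>
    (htype t).resolve_right fun ⟨k, hk, hI⟩ => not_isTypeI2 ((hc t).trans h.subset) hk hI
  have hmem : ∀ α ∈ φ, ∃ t, α ∈ c t := fun α hα => by
    rw [← Finset.mem_coe, hφ] at hα
    exact Set.mem_iUnion.1 hα
  constructor
  · intro α hα
    obtain ⟨t, ht⟩ := hmem α hα
    obtain ⟨γ, -, hγ⟩ := hA1 t
    apply hc t
    rw [← Finset.mem_coe, hγ] at ht ⊢
    rcases ht with rfl | rfl <;> simp
  · intro α hα β hβ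
    obtain ⟨t, ht⟩ := hmem α hα
    obtain ⟨t', ht'⟩ := hmem β hβ
    by_cases htt : t = t'
    · subst htt
      obtain ⟨γ, -, hγ⟩ := hA1 t
      rw [← Finset.mem_coe, hγ] at ht ht'
      rcases ht with rfl | rfl <;> rcases ht' with rfl | rfl <;> simp
    · exact Or.inr (Or.inr (horth t t' htt α ht β ht'))

/-- No pseudo-root is orthogonal to all of a 2-structure: the reflection in such a pseudo-root
would fix the 2-structure pointwise, and has sign `-1`. -/
lemma exists_inner_ne_zero (h : IsTwoStructure (rootsD n) (posRootsD n) φ) (s t : ℤˣ)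
    {i j : Fin n} (hij : i ≠ j) : ∃ α ∈ φ, ⟪signedRoot s t i j, α⟫ ≠ 0 := by
  by_contra! hcon
  have hfix : ∀ α ∈ φ, refl (signedRoot s t i j) α = α := fun α hα => by
    rw [refl_signedRoot_apply s t hij, hcon α hα]
    simp
  have hsign := h.sign_eq_one (refl (signedRoot s t i j))
    (Subgroup.subset_closure ⟨_, mem_rootsD.2 ⟨i, j, s, t, hij, rfl⟩, rfl⟩) (by
      ext x
      constructor
      · rintro ⟨y, hy, rfl⟩
        rwa [hfix y (Finset.mem_inter.1 hy).1]
      · intro hx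
        exact ⟨x, hx, hfix x (Finset.mem_inter.1 hx).1⟩)
  rw [(IsSignedPerm.refl_signedRoot s t hij).sign_eq, Equiv.Perm.sign_swap hij] at hsign
  exact absurd hsign (by decide)

lemma partner_unique (h : IsTwoStructure (rootsD n) (posRootsD n) φ) {s t s' t' : ℤˣ}
    {i j j' : Fin n} (hij : i ≠ j) (hij' : i ≠ j') (hα : signedRoot s t i j ∈ φ)
    (hβ : signedRoot s' t' i j' ∈ φ) : j = j' := by
  by_contra hne
  rcases h.neg_mem_and_orthogonal.2 _ hα _ hβ with h1 | h1 | h1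
  · rcases (signedRoot_eq_iff hij' hij).1 h1 with ⟨-, h2, -⟩ | ⟨h2, -⟩
    exacts [hne h2.symm, hij h2]
  · rw [neg_signedRoot] at h1
    rcases (signedRoot_eq_iff hij' hij).1 h1 with ⟨-, h2, -⟩ | ⟨h2, -⟩
    exacts [hne h2.symm, hij h2]
  · rw [inner_signedRoot_signedRoot] at h1
    simp [hij', hij.symm, hne] at h1

lemma signedRoot_mem (h : IsTwoStructure (rootsD n) (posRootsD n) φ) {s t : ℤˣ}
    {i j : Fin n} (hij : i ≠ j) (hα : signedRoot s t i j ∈ φ) (s' t' : ℤˣ) :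
    signedRoot s' t' i j ∈ φ := by
  have hneg := h.neg_mem_and_orthogonal.1
  have hα' : signedRoot (-s) (-t) i j ∈ φ := by
    rw [← neg_signedRoot]
    exact hneg _ hα
  by_contra hcon
  obtain ⟨β, hβ, hne⟩ := h.exists_inner_ne_zero s' t' hij
  obtain ⟨k, l, a, b, hkl, rfl⟩ := mem_rootsD.1 (h.subset hβ)
  have hβ' : signedRoot (-a) (-b) k l ∈ φ := by
    rw [← neg_signedRoot]
    exact hneg _ hβ
  -- the pseudo-root that is not orthogonal to `(s' e_i + t' e_j)/√2` has the same support
  have hsupp : (k = i ∧ l = j) ∨ (k = j ∧ l = i) := by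
    by_cases hki : k = i
    · subst hki
      exact Or.inl ⟨rfl, h.partner_unique hkl hij hβ hα⟩
    by_cases hli : l = i
    · subst hli
      rw [signedRoot_comm] at hβ
      exact Or.inr ⟨h.partner_unique hkl.symm hij hβ hα, rfl⟩
    rw [signedRoot_comm] at hα
    by_cases hkj : k = j
    · subst hkj
      exact Or.inr ⟨rfl, h.partner_unique hkl hij.symm hβ hα⟩
    by_cases hlj : l = j
    · subst hlj
      rw [signedRoot_comm] at hβ
      exact Or.inl ⟨h.partner_unique hkl.symm hij.symm hβ hα, rfl⟩
    refine absurd ?_ hne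
    rw [inner_signedRoot_signedRoot]
    simp [Ne.symm hki, Ne.symm hli, Ne.symm hkj, Ne.symm hlj]
  have hβ'' : ∃ a b, signedRoot a b i j ∈ φ ∧ signedRoot (-a) (-b) i j ∈ φ ∧
      ⟪signedRoot s' t' i j, signedRoot a b i j⟫ ≠ 0 := by
    rcases hsupp with ⟨rfl, rfl⟩ | ⟨rfl, rfl⟩
    · exact ⟨a, b, hβ, hβ', hne⟩
    · rw [signedRoot_comm] at hβ hβ'
      rw [signedRoot_comm a b] at hne
      exact ⟨b, a, hβ, hβ', hne⟩
  obtain ⟨a, b, h1, h2, h3⟩ := hβ''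
  rw [inner_signedRoot_signedRoot] at h3
  rcases Int.units_eq_one_or s' with rfl | rfl <;> rcases Int.units_eq_one_or t' with rfl | rfl <;>
    rcases Int.units_eq_one_or a with rfl | rfl <;> rcases Int.units_eq_one_or b with rfl | rfl <;>
    simp_all

/-- Every 2-structure of type `D_n` with `n` odd comes from a near-perfect matching. -/
lemma exists_eq_structureOf (hn : Odd n) (h : IsTwoStructure (rootsD n) (posRootsD n) φ) :
    ∃ f : Equiv.Perm (Fin n), IsNearPerfect f ∧ structureOf f = φ := by
  classical
  let R : Fin n → Fin n → Prop := fun i j => i ≠ j ∧ signedRoot 1 1 i j ∈ φ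
  have hR : ∀ {i j s t}, i ≠ j → signedRoot s t i j ∈ φ → R i j := fun hij hm =>
    ⟨hij, h.signedRoot_mem hij hm 1 1⟩
  have hsymm : ∀ {i j}, R i j → R j i := fun hij =>
    ⟨hij.1.symm, by rw [signedRoot_comm]; exact hij.2⟩
  have huniq : ∀ {i j j'}, R i j → R i j' → j = j' := fun h1 h2 =>
    h.partner_unique h1.1 h2.1 h1.2 h2.2
  let g : Fin n → Fin n := fun i => if hi : ∃ j, R i j then hi.choose else i
  have hgR : ∀ {i j}, R i j → g i = j := fun {i j} hij => by
    have hi : ∃ j, R i j := ⟨j, hij⟩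
    simp only [g, dif_pos hi]
    exact huniq hi.choose_spec hij
  have hg0 : ∀ i, (∀ j, ¬ R i j) → g i = i := fun i hi => by
    simp only [g]
    rw [dif_neg (by push Not; exact hi)]
  have hRg : ∀ i, g i ≠ i → R i (g i) := fun i hi => by
    by_cases hex : ∃ j, R i j
    · obtain ⟨j, hj⟩ := hex
      rwa [hgR hj]
    · push Not at hex
      exact absurd (hg0 i hex) hi
  have hinv : Function.Involutive g := fun i => by
    by_cases hi : g i = i
    · rw [hi, hi]
    · exact hgR (hsymm (hRg i hi))
  have hodd : ¬ 2 ∣ Fintype.card (Fin n) := by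
    rw [Fintype.card_fin]
    exact hn.not_two_dvd_nat
  obtain ⟨p, hp⟩ := Equiv.Perm.exists_fixed_point_of_prime (p := 2) (n := 1) hodd
    (σ := hinv.toPerm) (by ext i; simp [pow_two, hinv i])
  have hf : IsNearPerfect hinv.toPerm := by
    refine ⟨hinv, p, hp, fun q hq => ?_⟩
    by_contra hqp
    obtain ⟨α, hα, hne⟩ := h.exists_inner_ne_zero 1 1 hqp
    obtain ⟨k, l, a, b, hkl, rfl⟩ := mem_rootsD.1 (h.subset hα)
    have hkl' := hR hkl hα
    have h1 := hgR hkl'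
    have h2 := hgR (hsymm hkl')
    have hp' : g p = p := hp
    have hq' : g q = q := hq
    refine hne ?_
    rw [inner_signedRoot_signedRoot]
    have e1 : q ≠ k := by rintro rfl; exact hkl (hq'.symm.trans h1)
    have e2 : q ≠ l := by rintro rfl; exact hkl.symm (hq'.symm.trans h2)
    have e3 : p ≠ k := by rintro rfl; exact hkl (hp'.symm.trans h1)
    have e4 : p ≠ l := by rintro rfl; exact hkl.symm (hp'.symm.trans h2)
    simp [e1, e2, e3, e4]
  refine ⟨hinv.toPerm, hf, ?_⟩
  ext x
  constructor
  · intro hx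
    obtain ⟨i, s, t, hi, rfl⟩ := mem_structureOf.1 hx
    exact h.signedRoot_mem (Ne.symm hi) (hRg i hi).2 s t
  · intro hx
    obtain ⟨i, j, s, t, hij, rfl⟩ := mem_rootsD.1 (h.subset hx)
    exact (signedRoot_mem_structureOf hf s t hij).2 (hgR (hR hij hx))

end IsTwoStructure

/-- If `π` commutes with the involution `f`, then the action of `π` on the larger ends of the edges
is conjugate under `f` to its action on the smaller ends, so that `π` is even. -/
lemma sign_eq_one_of_commute {f π : Equiv.Perm (Fin n)} (hf : IsNearPerfect f)
    (hcomm : ∀ i, π (f i) = f (π i)) (hlt : ∀ i, i < f i ↔ π i < f (π i)) :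
    Equiv.Perm.sign π = 1 := by
  let ρ : Equiv.Perm (Fin n) :=
    Equiv.Perm.ofSubtype (π.subtypePerm (p := fun i => i < f i) fun i => (hlt i).symm)
  have hρ : ∀ i, ρ i = if i < f i then π i else i := by
    intro i
    split_ifs with h
    · exact Equiv.Perm.ofSubtype_apply_of_mem (p := fun i => i < f i) _ h
    · exact Equiv.Perm.ofSubtype_apply_of_not_mem (p := fun i => i < f i) _ h
  have hπ : π = ρ * (f * ρ * f) := by
    ext1 i
    simp only [Equiv.Perm.mul_apply, hρ, hf.apply_apply]
    rcases lt_trichotomy i (f i) with h | h | h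
    · rw [if_neg h.asymm, hf.apply_apply, if_pos h]
    · have hfix : f (π i) = π i := by rw [← hcomm, ← h]
      rw [← h, if_neg (lt_irrefl i), ← h, if_neg (lt_irrefl i)]
      exact hf.existsUnique_fixed.unique hfix h.symm
    · rw [if_pos h, hcomm, hf.apply_apply, if_neg]
      intro hc
      exact ((hlt i).2 hc).asymm h
  have hff : Equiv.Perm.sign f * Equiv.Perm.sign f = 1 := by
    rw [← Equiv.Perm.sign_mul, show f * f = 1 from Equiv.ext hf.apply_apply, map_one]
  rw [hπ]
  simp only [Equiv.Perm.sign_mul]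
  rcases Int.units_eq_one_or (Equiv.Perm.sign ρ) with h | h <;> rw [h] <;> simp [hff]

/-- A signed permutation that preserves the positive pseudo-roots of a 2-structure maps edges to
edges, smaller ends to smaller ends: the image of `e_i + t e_j` can only be positive for both signs
`t` if `e_i` goes to the smaller end. -/
lemma IsSignedPerm.inverse_preserves_edges {f π : Equiv.Perm (Fin n)} {s : Fin n → ℤˣ}
    {w : Space n ≃ₗᵢ[ℝ] Space n} (hπ : IsSignedPerm w π s) (hf : IsNearPerfect f)
    (hw : ∀ x, x ∈ structureOf f → x ∈ posRootsD n → w x ∈ structureOf f ∧ w x ∈ posRootsD n)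
    (i : Fin n) (hi : i < f i) : π⁻¹ (f i) = f (π⁻¹ i) ∧ π⁻¹ i < f (π⁻¹ i) := by
  have hne : π⁻¹ i ≠ π⁻¹ (f i) := π⁻¹.injective.ne hi.ne
  have hinv : ∀ k, π (π⁻¹ k) = k := π.apply_symm_apply
  have key : ∀ t : ℤˣ, signedRoot (s (π⁻¹ i)) (s (π⁻¹ (f i)) * t) (π⁻¹ i) (π⁻¹ (f i)) ∈
      structureOf f ∧ signedRoot (s (π⁻¹ i)) (s (π⁻¹ (f i)) * t) (π⁻¹ i) (π⁻¹ (f i)) ∈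
      posRootsD n := by
    intro t
    have h := hπ.apply_signedRoot 1 t (π⁻¹ i) (π⁻¹ (f i))
    rw [hinv, hinv, mul_one] at h
    rw [← h]
    have h' := (mem_structureOf_inter_posRootsD hf).2 ⟨i, t, hi, rfl⟩
    exact hw _ h'.1 h'.2
  have h1 : f (π⁻¹ i) = π⁻¹ (f i) := (signedRoot_mem_structureOf hf _ _ hne).1 (key 1).1
  refine ⟨h1.symm, ?_⟩
  rw [h1]
  by_contra hlt
  have hlt : π⁻¹ (f i) < π⁻¹ i := lt_of_le_of_ne (not_lt.1 hlt) hne.symm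
  have hp : ∀ t, s (π⁻¹ (f i)) * t = 1 := fun t => by
    have h := (key t).2
    rw [signedRoot_comm] at h
    exact (signedRoot_mem_posRootsD hlt).1 h
  exact absurd (mul_left_cancel ((hp 1).trans (hp (-1)).symm)) (by decide)

lemma comm_of_edges {f σ : Equiv.Perm (Fin n)} (hf : IsNearPerfect f)
    (h : ∀ i, i < f i → σ (f i) = f (σ i) ∧ σ i < f (σ i)) (i : Fin n) (hi : f i ≠ i) :
    σ (f i) = f (σ i) := by
  rcases lt_or_gt_of_ne hi with hlt | hlt
  · have := (h (f i) (by rwa [hf.apply_apply])).1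
    rw [hf.apply_apply] at this
    rw [this, hf.apply_apply]
  · exact (h i hlt).1

lemma isTwoStructure_structureOf {f : Equiv.Perm (Fin n)} (hf : IsNearPerfect f) :
    IsTwoStructure (rootsD n) (posRootsD n) (structureOf f) where
  subset := fun x hx => by
    obtain ⟨i, s, t, hi, rfl⟩ := mem_structureOf.1 hx
    exact mem_rootsD.2 ⟨_, _, s, t, hi.symm, rfl⟩
  decomposition := by
    classical
    let ι := {q : Fin n × ℤˣ // q.1 < f q.1}
    let v : ι → Space n := fun q => signedRoot 1 q.1.2 q.1.1 (f q.1.1)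
    have hv : ∀ q : ι, ‖v q‖ = 1 := fun q => norm_signedRoot _ _ q.2.ne
    have horth : ∀ q q' : ι, q ≠ q' → ⟪v q, v q'⟫ = 0 := by
      rintro ⟨⟨i, t⟩, hi⟩ ⟨⟨j, t'⟩, hj⟩ hne
      simp only [v, inner_signedRoot_signedRoot, f.injective.eq_iff]
      simp only at hi hj
      have e1 : i ≠ f j := by
        rintro rfl
        rw [hf.apply_apply] at hi
        exact hi.asymm hj
      have e2 : f i ≠ j := by
        rintro rfl
        rw [hf.apply_apply] at hj
        exact hi.asymm hj
      by_cases hij : i = j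
      · subst hij
        have htt : t ≠ t' := fun htt => hne (by subst htt; rfl)
        rcases Int.units_eq_one_or t with rfl | rfl <;>
          rcases Int.units_eq_one_or t' with rfl | rfl <;> simp_all
      · simp [e1, e2, hij]
    have horth' : ∀ q q' : ι, q ≠ q' → ∀ α ∈ ({v q, -v q} : Finset (Space n)),
        ∀ β ∈ ({v q', -v q'} : Finset (Space n)), ⟪α, β⟫ = 0 := by
      intro q q' hne α hα β hβ
      simp only [Finset.mem_insert, Finset.mem_singleton] at hα hβ
      rcases hα with rfl | rfl <;> rcases hβ with rfl | rfl <;> simp [horth q q' hne]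
    let ε := Fintype.equivFin ι
    refine ⟨Fintype.card ι, fun t => {v (ε.symm t), -v (ε.symm t)}, ?_, ?_, ?_, ?_⟩
    · ext x
      simp only [Finset.mem_coe, mem_structureOf, Set.mem_iUnion, Finset.mem_insert,
        Finset.mem_singleton]
      constructor
      · rintro ⟨i, s, t, hi, rfl⟩
        wlog hlt : i < f i generalizing i s t
        · have := this (f i) t s (fun h => hi (f.injective h)) (by
            rw [hf.apply_apply]
            exact lt_of_le_of_ne (not_lt.1 hlt) hi)
          rwa [hf.apply_apply, signedRoot_comm] at this
        rcases Int.units_eq_one_or s with rfl | rfl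
        · exact ⟨ε ⟨(i, t), hlt⟩, Or.inl (by simp [v])⟩
        · exact ⟨ε ⟨(i, -t), hlt⟩, Or.inr (by simp [v, neg_signedRoot])⟩
      · rintro ⟨t, rfl | rfl⟩
        · exact ⟨_, _, _, (ε.symm t).2.ne', rfl⟩
        · exact ⟨_, _, _, (ε.symm t).2.ne', (neg_signedRoot _ _ _ _).symm⟩
    · intro s t hst
      rw [Finset.disjoint_left]
      intro α hα hα'
      have h0 := horth' _ _ (ε.symm.injective.ne hst) α hα α hα'
      rw [inner_self_eq_zero] at h0
      subst h0
      simp only [Finset.mem_insert, Finset.mem_singleton] at hα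
      have hne : v (ε.symm s) ≠ 0 := norm_ne_zero_iff.1 (by rw [hv]; exact one_ne_zero)
      rcases hα with h | h
      exacts [hne h.symm, hne (neg_eq_zero.1 h.symm)]
    · intro s t hst
      exact horth' _ _ (ε.symm.injective.ne hst)
    · intro t
      exact Or.inl ⟨v (ε.symm t), hv _, by simp⟩
  sign_eq_one := by
    intro w hw himg
    obtain ⟨π, s, hπ⟩ := exists_isSignedPerm hw
    simp only [Finset.coe_inter, Set.ext_iff, Set.mem_image, Set.mem_inter_iff,
      Finset.mem_coe] at himg
    have hσ := hπ.inverse_preserves_edges hf fun x hx hx' => (himg (w x)).1 ⟨x, ⟨hx, hx'⟩, rfl⟩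
    have hπ' := hπ.inv.inverse_preserves_edges hf fun x hx hx' => by
      obtain ⟨y, hy, rfl⟩ := (himg x).2 ⟨hx, hx'⟩
      have : w⁻¹ (w y) = y := w.symm_apply_apply y
      rwa [this]
    rw [inv_inv] at hπ'
    have hσcomm : ∀ i, f i ≠ i → π⁻¹ (f i) = f (π⁻¹ i) := comm_of_edges hf hσ
    have hπcomm : ∀ i, f i ≠ i → π (f i) = f (π i) := comm_of_edges hf hπ'
    have hfix : ∀ i, f i = i → f (π i) = π i := fun i hi => by
      by_contra hne
      have := hσcomm _ hne
      rw [show π⁻¹ (π i) = i from π.symm_apply_apply i, hi] at this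
      exact hne (π⁻¹.injective (this.trans (π.symm_apply_apply i).symm))
    have hcomm : ∀ i, π (f i) = f (π i) := fun i => by
      by_cases hi : f i = i
      · rw [hi, hfix i hi]
      · exact hπcomm i hi
    rw [hπ.sign_eq, sign_eq_one_of_commute hf hcomm, Units.val_one]
    refine fun i => ⟨fun hi => (hπ' i hi).2, fun hi => ?_⟩
    rcases lt_trichotomy i (f i) with h | h | h
    · exact h
    · rw [hfix i h.symm] at hi
      exact absurd hi (lt_irrefl _)
    · have := (hπ' (f i) (by rwa [hf.apply_apply])).2
      rw [hcomm, hf.apply_apply] at this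
      exact absurd hi this.asymm

/-! ### Signs of matchings under adjacent transpositions -/

lemma mem_matchingOf_structureOf {f : Equiv.Perm (Fin n)} (hf : IsNearPerfect f)
    {q : Fin n × Fin n} : q ∈ matchingOf (structureOf f) ↔ q.1 < q.2 ∧ f q.1 = q.2 := by
  simp only [matchingOf, Finset.mem_filter, Finset.mem_univ, true_and, rootPlus_eq, rootMinus_eq]
  constructor
  · rintro ⟨h, h1, -⟩
    exact ⟨h, (signedRoot_mem_structureOf hf _ _ h.ne).1 h1⟩
  · rintro ⟨h, h1⟩
    exact ⟨h, (signedRoot_mem_structureOf hf _ _ h.ne).2 h1,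
      (signedRoot_mem_structureOf hf _ _ h.ne).2 h1⟩

lemma structureOf_injOn :
    Set.InjOn (structureOf (n := n)) {f | IsNearPerfect f} := by
  intro f hf g hg h
  ext1 i
  by_cases hi : f i = i
  · by_contra hne
    have hgi : i ≠ g i := fun h' => hne (hi.trans h')
    have := (signedRoot_mem_structureOf hg 1 1 hgi).2 rfl
    rw [← h] at this
    exact hne ((signedRoot_mem_structureOf hf 1 1 hgi).1 this)
  · have := (signedRoot_mem_structureOf hf 1 1 (Ne.symm hi)).2 rfl
    rw [h] at this
    exact ((signedRoot_mem_structureOf hg 1 1 (Ne.symm hi)).1 this).symm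

/-- The pairs `(a, c)` of smaller ends of two crossing edges, `a < c < f a < f c`. -/
def crossingPairs (f : Equiv.Perm (Fin n)) : Finset (Fin n × Fin n) :=
  Finset.univ.filter fun q => q.1 < q.2 ∧ q.2 < f q.1 ∧ f q.1 < f q.2

lemma mem_crossingPairs {f : Equiv.Perm (Fin n)} {q : Fin n × Fin n} :
    q ∈ crossingPairs f ↔ q.1 < q.2 ∧ q.2 < f q.1 ∧ f q.1 < f q.2 := by
  simp [crossingPairs]

lemma crossings_matchingOf {f : Equiv.Perm (Fin n)} (hf : IsNearPerfect f) :
    crossings (matchingOf (structureOf f)) = (crossingPairs f).card := by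
  refine Finset.card_nbij' (fun q => (q.1.1, q.2.1)) (fun q => ((q.1, f q.1), (q.2, f q.2)))
    ?_ ?_ ?_ ?_
  · rintro ⟨⟨a, b⟩, ⟨c, d⟩⟩ h
    simp only [Finset.coe_filter, Finset.mem_product, mem_matchingOf_structureOf hf,
      Set.mem_ofPred_eq] at h
    obtain ⟨⟨⟨-, rfl⟩, -, rfl⟩, h⟩ := h
    simpa [crossingPairs] using h
  · rintro ⟨a, c⟩ h
    simp only [crossingPairs, Finset.coe_filter, Finset.mem_univ, true_and,
      Set.mem_ofPred_eq] at h
    simp only [Finset.coe_filter, Finset.mem_product, mem_matchingOf_structureOf hf,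
      Set.mem_ofPred_eq]
    exact ⟨⟨⟨h.1.trans h.2.1, trivial⟩, h.2.1.trans h.2.2, trivial⟩, h⟩
  · rintro ⟨⟨a, b⟩, ⟨c, d⟩⟩ h
    simp only [Finset.coe_filter, Finset.mem_product, mem_matchingOf_structureOf hf,
      Set.mem_ofPred_eq] at h
    obtain ⟨⟨⟨-, rfl⟩, -, rfl⟩, h⟩ := h
    rfl
  · rintro ⟨a, c⟩ h
    rfl

lemma isolated_matchingOf {f : Equiv.Perm (Fin n)} (hf : IsNearPerfect f) :
    isolated (matchingOf (structureOf f)) = Finset.univ.filter fun p => f p = p := by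
  ext p
  simp only [isolated, Finset.mem_filter, Finset.mem_univ, true_and,
    mem_matchingOf_structureOf hf]
  constructor
  · intro h
    by_contra hp
    rcases lt_or_gt_of_ne hp with hlt | hlt
    · exact (h (f p, p) ⟨hlt, hf.apply_apply p⟩).2 rfl
    · exact (h (p, f p) ⟨hlt, rfl⟩).1 rfl
  · rintro h ⟨a, b⟩ ⟨hab, hfab⟩
    constructor
    · rintro rfl
      exact hab.ne (h.symm.trans hfab)
    · rintro rfl
      exact hab.ne (by rw [← hf.apply_apply a]; exact (congrArg f hfab).trans h)

/-- The sign of a near-perfect matching with isolated vertex `p` is `-1` to the number of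
crossings plus `p`. -/
lemma epsilonD_structureOf {f : Equiv.Perm (Fin n)} (hf : IsNearPerfect f) {p : Fin n}
    (hp : f p = p) :
    epsilonD (structureOf f) = (-1) ^ ((crossingPairs f).card + (p : ℕ)) := by
  have h : (Finset.univ.filter fun p => f p = p) = {p} := by
    ext q
    simp only [Finset.mem_filter, Finset.mem_univ, true_and, Finset.mem_singleton]
    exact ⟨fun hq => hf.existsUnique_fixed.unique hq hp, fun hq => hq ▸ hp⟩
  rw [epsilonD, matchingSign, crossings_matchingOf hf, isolated_matchingOf hf, h,
    Finset.sum_singleton]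

lemma IsNearPerfect.conj {f τ : Equiv.Perm (Fin n)} (hf : IsNearPerfect f)
    (hτ : ∀ i, τ (τ i) = i) : IsNearPerfect (τ * f * τ) := by
  obtain ⟨p, hp, huniq⟩ := hf.existsUnique_fixed
  refine ⟨fun i => by simp [hτ, hf.apply_apply], τ p, by simp [hτ, hp], fun q hq => ?_⟩
  rw [← hτ q]
  have hq' : τ (f (τ q)) = q := hq
  exact congrArg τ (huniq _ ((hτ (f (τ q))).symm.trans (congrArg τ hq')))

/-- An adjacent transposition preserves the order of every pair except the one it exchanges. -/
lemma swap_lt_swap_iff {k k' : Fin n} (hk : (k' : ℕ) = k + 1) (a b : Fin n) :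
    Equiv.swap k k' a < Equiv.swap k k' b ↔
      (a < b ∧ ¬ (a = k ∧ b = k')) ∨ (a = k' ∧ b = k) := by
  simp only [Equiv.swap_apply_def, Fin.lt_def, Fin.ext_iff]
  split_ifs <;> omega

lemma neg_one_pow_card_filter_eq_neg {ι : Type*} [Fintype ι] {P Q : ι → Prop} [DecidablePred P]
    [DecidablePred Q] (s : ι) (h : ∀ q, (P q ↔ Q q) ↔ q ≠ s) :
    (-1 : ℤ) ^ (Finset.univ.filter P).card = -(-1) ^ (Finset.univ.filter Q).card := by
  classical
  have key : ∀ (R : ι → Prop) [DecidablePred R], (-1 : ℤ) ^ (Finset.univ.filter R).card =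
      (if R s then -1 else 1) * ∏ q ∈ Finset.univ.erase s, if R q then -1 else 1 := fun R _ => by
    rw [Finset.mul_prod_erase Finset.univ (fun q => if R q then (-1 : ℤ) else 1)
      (Finset.mem_univ s), Finset.prod_ite, Finset.prod_const, Finset.prod_const_one, mul_one]
  rw [key P, key Q, ← neg_mul]
  congr 1
  · have := h s
    by_cases hP : P s <;> by_cases hQ : Q s <;> simp_all
  · exact Finset.prod_congr rfl fun q hq =>
      if_congr ((h q).2 (Finset.ne_of_mem_erase hq)) rfl rfl

/-- The crossing pairs of the matching conjugated by an involution `τ` are counted after moving them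
back by `τ`. -/
lemma card_crossingPairs_conj (f : Equiv.Perm (Fin n)) {τ : Equiv.Perm (Fin n)}
    (hτ : ∀ i, τ (τ i) = i) :
    (crossingPairs (τ * f * τ)).card = (Finset.univ.filter fun q : Fin n × Fin n =>
      τ q.1 < τ q.2 ∧ τ q.2 < τ (f q.1) ∧ τ (f q.1) < τ (f q.2)).card := by
  refine Finset.card_nbij' (fun q => (τ q.1, τ q.2)) (fun q => (τ q.1, τ q.2)) ?_ ?_ ?_ ?_ <;>
    rintro ⟨a, c⟩ h <;>
    simp only [Finset.mem_coe, mem_crossingPairs, Finset.mem_filter, Finset.mem_univ, true_and,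
      Equiv.Perm.mul_apply, hτ] at h ⊢ <;> exact h

lemma crossing_swap_iff_of_fixed {f : Equiv.Perm (Fin n)} (hf : IsNearPerfect f) {k k' : Fin n}
    (hk : (k' : ℕ) = k + 1) (hfix : f k = k ∨ f k' = k') (a c : Fin n) :
    (Equiv.swap k k' a < Equiv.swap k k' c ∧ Equiv.swap k k' c < Equiv.swap k k' (f a) ∧
      Equiv.swap k k' (f a) < Equiv.swap k k' (f c)) ↔ a < c ∧ c < f a ∧ f a < f c := by
  have ha := hf.apply_apply a
  have hc := hf.apply_apply c
  simp only [swap_lt_swap_iff hk]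
  grind

/-- If the edges at `k` and `k + 1` are distinct, then conjugation by the transposition of `k` and
`k + 1` changes the crossing condition at exactly one pair `s`.  It consists of one end of each of
these edges, `k` with partner `x` and `k + 1` with partner `y`, and depends on the positions of `x`
and `y`. -/
lemma exists_crossing_swap_iff {f : Equiv.Perm (Fin n)} (hf : IsNearPerfect f) {k k' : Fin n}
    (hk : (k' : ℕ) = k + 1) (h1 : f k ≠ k) (h2 : f k' ≠ k') (h3 : f k ≠ k') :
    ∃ s : Fin n × Fin n, ∀ a c : Fin n,
      ((Equiv.swap k k' a < Equiv.swap k k' c ∧ Equiv.swap k k' c < Equiv.swap k k' (f a) ∧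
        Equiv.swap k k' (f a) < Equiv.swap k k' (f c)) ↔ (a < c ∧ c < f a ∧ f a < f c)) ↔
        (a, c) ≠ s := by
  simp only [swap_lt_swap_iff hk]
  obtain ⟨x, hx⟩ : ∃ x, f k = x := ⟨_, rfl⟩
  obtain ⟨y, hy⟩ : ∃ y, f k' = y := ⟨_, rfl⟩
  have hx' : f x = k := by rw [← hx, hf.apply_apply]
  have hy' : f y = k' := by rw [← hy, hf.apply_apply]
  refine ⟨if x < k then (if y < k then (if x < y then (x, y) else (y, x)) else (x, k'))
    else (if y < k then (y, k) else (if x < y then (k, k') else (k', k))), fun a c => ?_⟩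
  have ha := hf.apply_apply a
  have hc := hf.apply_apply c
  grind

/-- Conjugation by the transposition of `k` and `k + 1` changes the sign of a near-perfect matching
that does not join `k` and `k + 1`: if neither is isolated, then exactly one pair of edges changes
between crossing and not crossing, namely the two edges at `k` and `k + 1`; otherwise the crossings
are the same and the isolated vertex moves by one. -/
lemma epsilonD_structureOf_conj {f : Equiv.Perm (Fin n)} (hf : IsNearPerfect f) {k k' : Fin n}
    (hk : (k' : ℕ) = k + 1) (hne : f k ≠ k') :
    epsilonD (structureOf (Equiv.swap k k' * f * Equiv.swap k k')) = -epsilonD (structureOf f) := by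
  have hkk : k ≠ k' := by
    rintro rfl
    omega
  have hτ : ∀ i, Equiv.swap k k' (Equiv.swap k k' i) = i := Equiv.swap_apply_self k k'
  obtain ⟨p, hp, -⟩ := hf.existsUnique_fixed
  have hp' : (Equiv.swap k k' * f * Equiv.swap k k') (Equiv.swap k k' p) = Equiv.swap k k' p := by
    simp only [Equiv.Perm.mul_apply, hτ, show f p = p from hp]
  rw [epsilonD_structureOf hf hp, epsilonD_structureOf (hf.conj hτ) hp', pow_add, pow_add,
    card_crossingPairs_conj f hτ]
  by_cases hfix : f k = k ∨ f k' = k'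
  · have hval : (-1 : ℤ) ^ (Equiv.swap k k' p : ℕ) = -(-1) ^ (p : ℕ) := by
      rcases hfix with h | h
      · rw [hf.existsUnique_fixed.unique hp h, Equiv.swap_apply_left, hk, pow_succ, mul_neg_one]
      · rw [hf.existsUnique_fixed.unique hp h, Equiv.swap_apply_right, hk, pow_succ, mul_neg_one,
          neg_neg]
    simp only [crossing_swap_iff_of_fixed hf hk hfix]
    rw [hval, mul_neg]
    rfl
  · push Not at hfix
    have hpk : p ≠ k := fun h => hfix.1 (h ▸ hp)
    have hpk' : p ≠ k' := fun h => hfix.2 (h ▸ hp)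
    rw [Equiv.swap_apply_of_ne_of_ne hpk hpk', ← neg_mul]
    congr 1
    obtain ⟨s, hs⟩ := exists_crossing_swap_iff hf hk hfix.1 hfix.2 hne
    exact neg_one_pow_card_filter_eq_neg s fun q => hs q.1 q.2

/-! ### The polynomials `T_d` and their symmetries -/

open MvPolynomial in
/-- The polynomial `T_d` is symmetric, and odd in every variable. -/
lemma aeval_taylorPoly_equiv {ι κ : Type} [Fintype ι] [Fintype κ] {A : Type*} [CommRing A]
    [Algebra ℝ A] (d : ℕ) (ε : ι ≃ κ) (u : ι → ℤˣ) (x : ι → A) (y : κ → A)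
    (h : ∀ i, x i = ((u i : ℤ) : A) * y (ε i)) :
    aeval x (taylorPoly n d ι) = ((∏ i, u i : ℤˣ) : ℤ) * aeval y (taylorPoly n d κ) := by
  classical
  rw [taylorPoly, taylorPoly, Fintype.card_congr ε]
  split_ifs with hd
  · simp only [map_mul, map_sum, map_prod, map_pow, aeval_X, ← algebraMap_eq,
      AlgHom.commutes]
    rw [mul_left_comm]
    congr 1
    rw [Finset.mul_sum]
    refine Finset.sum_nbij' (fun r => r ∘ ε.symm) (fun r => r ∘ ε) ?_ ?_ ?_ ?_ ?_
    · intro r hr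
      rw [Finset.mem_piAntidiag] at hr ⊢
      exact ⟨by rw [← hr.1]; exact Equiv.sum_comp ε.symm r, by simp⟩
    · intro r hr
      rw [Finset.mem_piAntidiag] at hr ⊢
      exact ⟨by rw [← hr.1]; exact Equiv.sum_comp ε r, by simp⟩
    · intro r _
      ext i
      simp
    · intro r _
      ext i
      simp
    · intro r _
      have hmult : Nat.multinomial Finset.univ (r ∘ ε.symm) = Nat.multinomial Finset.univ r := by
        rw [Nat.multinomial, Nat.multinomial]
        congr 1
        · exact congrArg _ (Equiv.sum_comp ε.symm r)
        · exact Equiv.prod_comp ε.symm fun i => (r i).factorial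
      rw [hmult, mul_left_comm]
      congr 1
      rw [← Equiv.prod_comp ε, Units.coe_prod, Int.cast_prod, ← Finset.prod_mul_distrib]
      refine Finset.prod_congr rfl fun i _ => ?_
      have hu : ((u i : ℤ) : A) ^ (2 * r i + 1) = ((u i : ℤ) : A) := by
        rcases Int.units_eq_one_or (u i) with h | h <;> simp [h, pow_succ, pow_mul]
      simp only [Function.comp_apply, Equiv.symm_apply_apply]
      rw [h, mul_pow, hu]
      ring
  · simp

lemma isHomogeneous_taylorPoly (d : ℕ) (ι : Type) [Fintype ι] :
    (taylorPoly n d ι).IsHomogeneous d := by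
  classical
  rw [taylorPoly]
  split_ifs with hd
  · refine MvPolynomial.IsHomogeneous.C_mul (MvPolynomial.IsHomogeneous.sum _ _ _ fun r hr => ?_) _
    refine MvPolynomial.IsHomogeneous.C_mul ?_ _
    rw [Finset.mem_piAntidiag] at hr
    have hsum : ∑ i, (2 * r i + 1) = d := by
      rw [Finset.sum_add_distrib, ← Finset.mul_sum, hr.1, Finset.sum_const, smul_eq_mul, mul_one,
        Finset.card_univ, Nat.two_mul_div_two_of_even hd.2]
      omega
    rw [← hsum]
    exact MvPolynomial.IsHomogeneous.prod _ _ _ fun i _ =>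
      MvPolynomial.isHomogeneous_C_mul_X_pow _ _ _
  · exact MvPolynomial.isHomogeneous_zero _ _ _

lemma isHomogeneous_linForm (x : Space n) : (linForm x).IsHomogeneous 1 :=
  MvPolynomial.IsHomogeneous.sum _ _ _ fun _ _ => MvPolynomial.isHomogeneous_C_mul_X _ _

lemma linForm_signedRoot (s t : ℤˣ) (i j : Fin n) :
    linForm (signedRoot s t i j) = MvPolynomial.C (√2)⁻¹ *
      (((s : ℤ) : MvPolynomial (Fin n) ℝ) * MvPolynomial.X i +
        ((t : ℤ) : MvPolynomial (Fin n) ℝ) * MvPolynomial.X j) := by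
  have h : ∀ (u : ℤˣ) (k : Fin n), ∑ l, MvPolynomial.C ((√2)⁻¹ *
      (if l = k then ((u : ℤ) : ℝ) else 0)) * MvPolynomial.X l =
      MvPolynomial.C (√2)⁻¹ *
        (((u : ℤ) : MvPolynomial (Fin n) ℝ) * MvPolynomial.X k) := fun u k => by
    rw [Finset.sum_eq_single k (fun l _ hl => by simp [hl]) (by simp), if_pos rfl, map_mul,
      map_intCast, mul_assoc]
  simp only [linForm, signedRoot_apply, mul_add, map_add, add_mul, Finset.sum_add_distrib]
  rw [h, h]

/-- The positive pseudo-roots of a matching, indexed by its matched vertices: the smaller end of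
an edge `{i < j}` stands for `(e_i + e_j)/√2` and the larger end for `(e_i - e_j)/√2`. -/
def vertexRoot (f : Equiv.Perm (Fin n)) (i : Fin n) : Space n :=
  if i < f i then signedRoot 1 1 i (f i) else signedRoot 1 (-1) (f i) i

/-- The polynomial `T_d(φ⁺; a)` for the 2-structure `φ` of the matching given by `f`. -/
def matchingPoly (d : ℕ) (f : Equiv.Perm (Fin n)) : MvPolynomial (Fin n) ℝ :=
  MvPolynomial.aeval (fun i : {i // f i ≠ i} => linForm (vertexRoot f i))
    (taylorPoly n d {i // f i ≠ i})

lemma bijOn_vertexRoot {f : Equiv.Perm (Fin n)} (hf : IsNearPerfect f) :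
    Set.BijOn (vertexRoot f) {i | f i ≠ i} {x | x ∈ structureOf f ∧ x ∈ posRootsD n} := by
  refine ⟨fun i hi => ?_, fun i hi j hj hij => ?_, fun x hx => ?_⟩
  · rw [Set.mem_ofPred_eq, mem_structureOf_inter_posRootsD hf, vertexRoot]
    split_ifs with h
    · exact ⟨i, 1, h, rfl⟩
    · have hlt : f i < i := lt_of_le_of_ne (not_lt.1 h) hi
      exact ⟨f i, -1, by rwa [hf.apply_apply], by rw [hf.apply_apply]⟩
  · have h1 : (1 : ℤˣ) ≠ -1 := by decide
    simp only [vertexRoot] at hij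
    split_ifs at hij with hi' hj' hj' <;>
      rw [signedRoot_eq_iff (by first | exact hi | exact Ne.symm hi)
        (by first | exact hj | exact Ne.symm hj)] at hij
    · rcases hij with h | ⟨h, h', -⟩
      · exact h.1
      · rw [h'] at hi'
        rw [← h] at hj'
        exact absurd hi' hj'.asymm
    · rcases hij with ⟨-, -, -, h⟩ | ⟨-, -, h, -⟩
      exacts [absurd h h1, absurd h h1]
    · rcases hij with ⟨-, -, -, h⟩ | ⟨-, -, -, h⟩
      exacts [absurd h h1.symm, absurd h h1.symm]
    · rcases hij with h | ⟨-, -, h, -⟩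
      exacts [h.2.1, absurd h h1]
  · obtain ⟨i, t, hi, rfl⟩ := (mem_structureOf_inter_posRootsD hf).1 hx
    rcases Int.units_eq_one_or t with rfl | rfl
    · exact ⟨i, hi.ne', by rw [vertexRoot, if_pos hi]⟩
    · refine ⟨f i, fun h => hi.ne' (f.injective h), ?_⟩
      rw [vertexRoot, hf.apply_apply, if_neg hi.asymm]

lemma taylorPolySet_eq_matchingPoly (d : ℕ) {f : Equiv.Perm (Fin n)} (hf : IsNearPerfect f)
    {ψ : Finset (Space n)} (hψ : ∀ x, x ∈ ψ ↔ x ∈ structureOf f ∧ x ∈ posRootsD n) :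
    taylorPolySet d ψ = matchingPoly d f := by
  have hbij := bijOn_vertexRoot hf
  let ε : {i // f i ≠ i} ≃ ψ := Equiv.ofBijective
    (fun i => ⟨vertexRoot f i, (hψ _).2 (hbij.mapsTo i.2)⟩)
    ⟨fun i j hij => Subtype.ext (hbij.injOn i.2 j.2 (congrArg Subtype.val hij)), fun x => by
      obtain ⟨i, hi, h⟩ := hbij.surjOn ((hψ _).1 x.2)
      exact ⟨⟨i, hi⟩, Subtype.ext h⟩⟩
  rw [taylorPolySet, matchingPoly,
    aeval_taylorPoly_equiv d ε 1 _ (fun x : ψ => linForm (x : Space n)) (fun i => by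
      rw [Pi.one_apply, Units.val_one, Int.cast_one, one_mul]
      rfl)]
  simp

lemma algHom_matchingPoly (d : ℕ) {f g : Equiv.Perm (Fin n)}
    (Φ : MvPolynomial (Fin n) ℝ →ₐ[ℝ] MvPolynomial (Fin n) ℝ)
    (ε : {i // f i ≠ i} ≃ {i // g i ≠ i}) (u : {i // f i ≠ i} → ℤˣ)
    (h : ∀ i : {i // f i ≠ i}, Φ (linForm (vertexRoot f i)) =
      ((u i : ℤ) : MvPolynomial (Fin n) ℝ) * linForm (vertexRoot g (ε i))) :
    Φ (matchingPoly d f) = ((∏ i, u i : ℤˣ) : ℤ) * matchingPoly d g := by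
  rw [matchingPoly, matchingPoly, MvPolynomial.comp_aeval_apply]
  exact aeval_taylorPoly_equiv d ε u _ _ h

lemma isHomogeneous_matchingPoly (d : ℕ) (f : Equiv.Perm (Fin n)) :
    (matchingPoly d f).IsHomogeneous d := by
  have := (isHomogeneous_taylorPoly (n := n) d {i // f i ≠ i}).aeval
    (fun i => linForm (vertexRoot f i)) (n := 1) fun i => isHomogeneous_linForm _
  rwa [one_mul] at this

/-- The polynomial of a matching does not involve the variable of the isolated vertex. -/
lemma matchingPoly_mem_supported (d : ℕ) {f : Equiv.Perm (Fin n)} (hf : IsNearPerfect f)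
    {p : Fin n} (hp : f p = p) :
    matchingPoly d f ∈ MvPolynomial.supported ℝ ({p}ᶜ : Set (Fin n)) := by
  have hlin : ∀ i : {i // f i ≠ i},
      linForm (vertexRoot f i) ∈ MvPolynomial.supported ℝ ({p}ᶜ : Set (Fin n)) := by
    rintro ⟨i, hi⟩
    have key : ∀ (s t : ℤˣ) (i j : Fin n), i ≠ p → j ≠ p →
        linForm (signedRoot s t i j) ∈ MvPolynomial.supported ℝ ({p}ᶜ : Set (Fin n)) := by
      intro s t i j hi hj
      rw [linForm_signedRoot]
      refine mul_mem (Subalgebra.algebraMap_mem _ _) (add_mem ?_ ?_) <;>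
        exact mul_mem (intCast_mem _ _) (MvPolynomial.X_mem_supported.2 ‹_›)
    have h1 : i ≠ p := fun h => hi (h ▸ hp)
    have h2 : f i ≠ p := fun h => h1 (by rw [← hf.apply_apply i, h, hp])
    simp only [vertexRoot]
    split_ifs
    exacts [key _ _ _ _ h1 h2, key _ _ _ _ h2 h1]
  have hmem : matchingPoly d f ∈
      (MvPolynomial.aeval (R := ℝ) fun i : {i // f i ≠ i} => linForm (vertexRoot f i)).range :=
    ⟨_, rfl⟩
  rw [← Algebra.adjoin_range_eq_range_aeval] at hmem
  exact Algebra.adjoin_le (Set.range_subset_iff.2 hlin) hmem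

/-- The substitution `X_k ↦ -X_k`, which describes the reflection in the hyperplane `x_k = 0`. -/
def flip (k : Fin n) : MvPolynomial (Fin n) ℝ →ₐ[ℝ] MvPolynomial (Fin n) ℝ :=
  MvPolynomial.aeval fun j => if j = k then -MvPolynomial.X j else MvPolynomial.X j

lemma flip_linForm_signedRoot (k : Fin n) (s t : ℤˣ) (i j : Fin n) :
    flip k (linForm (signedRoot s t i j)) =
      linForm (signedRoot (if i = k then -s else s) (if j = k then -t else t) i j) := by
  rw [linForm_signedRoot, linForm_signedRoot]
  simp only [flip, map_mul, map_add, map_intCast, MvPolynomial.aeval_X, MvPolynomial.aeval_C,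
    MvPolynomial.algebraMap_eq]
  split_ifs <;> simp

lemma linForm_neg (x : Space n) : linForm (-x) = -linForm x := by
  simp [linForm]

/-- The two factors of an edge at `k` are exchanged by `X_k ↦ -X_k`, up to a sign that is the same
for both, and the other factors are fixed. -/
lemma flip_matchingPoly (d : ℕ) {f : Equiv.Perm (Fin n)} (hf : IsNearPerfect f) (k : Fin n) :
    flip k (matchingPoly d f) = matchingPoly d f := by
  by_cases hk : f k = k
  · rw [algHom_matchingPoly d (flip k) (Equiv.refl _) 1 (g := f)]
    · simp
    · rintro ⟨i, hi⟩
      have h1 : i ≠ k := fun h => hi (h ▸ hk)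
      have h2 : f i ≠ k := fun h => h1 (by rw [← hf.apply_apply i, h, hk])
      change flip k (linForm (vertexRoot f i)) = _ * linForm (vertexRoot f i)
      simp only [vertexRoot]
      split_ifs <;> simp [flip_linForm_signedRoot, h1, h2]
  · have hk' : f (f k) ≠ f k := fun h => hk (f.injective h)
    let c : ℤˣ := if k < f k then -1 else 1
    rw [algHom_matchingPoly d (flip k) (Equiv.swap ⟨k, hk⟩ ⟨f k, hk'⟩)
      (fun i => (if i = ⟨k, hk⟩ then c else 1) * if i = ⟨f k, hk'⟩ then c else 1) (g := f)]
    · rw [Finset.prod_mul_distrib, Finset.prod_ite_eq', Finset.prod_ite_eq']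
      simp
    · rintro ⟨i, hi⟩
      by_cases h1 : i = k
      · subst h1
        have hne : (⟨i, hk⟩ : {i // f i ≠ i}) ≠ ⟨f i, hk'⟩ := fun h =>
          hk (congrArg Subtype.val h).symm
        rw [Equiv.swap_apply_left, if_pos rfl, if_neg hne]
        simp only [vertexRoot, hf.apply_apply, c]
        rcases lt_or_gt_of_ne hk with h | h
        · simp only [h, h.asymm, if_true, if_false, flip_linForm_signedRoot, hk]
          simp
        · simp only [h, h.asymm, if_true, if_false, flip_linForm_signedRoot, hk]
          rw [mul_one, Units.val_neg, Units.val_one, Int.cast_neg, Int.cast_one, neg_one_mul,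
            ← linForm_neg, neg_signedRoot, neg_neg]
      · by_cases h2 : i = f k
        · subst h2
          have hne : (⟨f k, hk'⟩ : {i // f i ≠ i}) ≠ ⟨k, hk⟩ := fun h => hk (congrArg Subtype.val h)
          rw [Equiv.swap_apply_right, if_pos rfl, if_neg hne]
          simp only [vertexRoot, hf.apply_apply, c]
          rcases lt_or_gt_of_ne hk with h | h
          · simp only [h, h.asymm, if_true, if_false, flip_linForm_signedRoot, hk]
            simp
          · simp only [h, h.asymm, if_true, if_false, flip_linForm_signedRoot, hk]
            rw [one_mul, Units.val_neg, Units.val_one, Int.cast_neg, Int.cast_one, neg_one_mul,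
              ← linForm_neg, neg_signedRoot]
        · have h3 : f i ≠ k := fun h => h2 (by rw [← h, hf.apply_apply])
          rw [Equiv.swap_apply_of_ne_of_ne (by simpa using h1) (by simpa using h2)]
          simp only [vertexRoot, Subtype.mk.injEq, h1, h2]
          split_ifs <;> simp [flip_linForm_signedRoot, h1, h3]

lemma rename_linForm_signedRoot (τ : Fin n → Fin n) (s t : ℤˣ) (i j : Fin n) :
    MvPolynomial.rename τ (linForm (signedRoot s t i j)) =
      linForm (signedRoot s t (τ i) (τ j)) := by
  simp [linForm_signedRoot]

/-- Exchanging two adjacent variables conjugates the matching by the transposition, up to the sign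
that comes from the factor `(a_k - a_{k + 1})/√2` if `k` and `k + 1` are joined. -/
lemma epsilonD_mul_rename_matchingPoly (d : ℕ) {f : Equiv.Perm (Fin n)} (hf : IsNearPerfect f)
    {k k' : Fin n} (hk : (k' : ℕ) = k + 1) :
    (epsilonD (structureOf f) : MvPolynomial (Fin n) ℝ) *
        MvPolynomial.rename (Equiv.swap k k') (matchingPoly d f) =
      -((epsilonD (structureOf (Equiv.swap k k' * f * Equiv.swap k k')) :
        MvPolynomial (Fin n) ℝ) *
          matchingPoly d (Equiv.swap k k' * f * Equiv.swap k k')) := by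
  have hkk : k ≠ k' := by
    rintro rfl
    omega
  have hlt : k < k' := Fin.lt_def.2 (by omega)
  have hτ : ∀ i, Equiv.swap k k' (Equiv.swap k k' i) = i := Equiv.swap_apply_self k k'
  by_cases hfk : f k = k'
  · have hfk' : f k' = k := by rw [← hfk, hf.apply_apply]
    have hconj : Equiv.swap k k' * f * Equiv.swap k k' = f := by
      ext1 i
      simp only [Equiv.Perm.mul_apply]
      by_cases h1 : i = k
      · subst h1
        rw [Equiv.swap_apply_left, hfk', Equiv.swap_apply_left, hfk]
      by_cases h2 : i = k'
      · subst h2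
        rw [Equiv.swap_apply_right, hfk, Equiv.swap_apply_right, hfk']
      rw [Equiv.swap_apply_of_ne_of_ne h1 h2, Equiv.swap_apply_of_ne_of_ne]
      · exact fun h => h2 (by rw [← hfk, ← h, hf.apply_apply])
      · exact fun h => h1 (by rw [← hfk', ← h, hf.apply_apply])
    rw [hconj, ← mul_neg]
    congr 1
    have hk' : f k' ≠ k' := by rwa [hfk']
    rw [algHom_matchingPoly d (MvPolynomial.rename (Equiv.swap k k')) (Equiv.refl _)
      (fun i => if i = ⟨k', hk'⟩ then -1 else 1) (g := f)]
    · rw [Finset.prod_ite_eq']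
      simp
    · rintro ⟨i, hi⟩
      change MvPolynomial.rename _ (linForm (vertexRoot f i)) = _ * linForm (vertexRoot f i)
      simp only [vertexRoot, Subtype.mk.injEq]
      by_cases h1 : i = k
      · subst h1
        rw [hfk, if_pos hlt, if_neg hkk, rename_linForm_signedRoot, Equiv.swap_apply_left,
          Equiv.swap_apply_right, signedRoot_comm]
        simp
      by_cases h2 : i = k'
      · subst h2
        rw [hfk', if_neg hlt.asymm, if_pos rfl, rename_linForm_signedRoot, Equiv.swap_apply_left,
          Equiv.swap_apply_right, signedRoot_comm, Units.val_neg, Units.val_one, Int.cast_neg,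
          Int.cast_one, neg_one_mul, ← linForm_neg, neg_signedRoot, neg_neg]
      have h3 : f i ≠ k := fun h => h2 (by rw [← hfk, ← h, hf.apply_apply])
      have h4 : f i ≠ k' := fun h => h1 (by rw [← hfk', ← h, hf.apply_apply])
      split_ifs <;> simp [rename_linForm_signedRoot, Equiv.swap_apply_of_ne_of_ne, *]
  · have hfk' : f k' ≠ k := fun h => hfk (by rw [← h, hf.apply_apply])
    rw [epsilonD_structureOf_conj hf hk hfk, Int.cast_neg, neg_mul, neg_neg]
    congr 1
    have hiff : ∀ i, f i ≠ i ↔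
        (Equiv.swap k k' * f * Equiv.swap k k') (Equiv.swap k k' i) ≠ Equiv.swap k k' i :=
      fun i => by simp [hτ]
    rw [algHom_matchingPoly d (MvPolynomial.rename (Equiv.swap k k'))
      ((Equiv.swap k k').subtypeEquiv hiff) 1]
    · simp
    · rintro ⟨i, hi⟩
      have hord : Equiv.swap k k' i < Equiv.swap k k' (f i) ↔ i < f i := by
        rw [swap_lt_swap_iff hk]
        constructor
        · rintro (h | ⟨rfl, h⟩)
          exacts [h.1, absurd h hfk']
        · intro h
          refine Or.inl ⟨h, ?_⟩
          rintro ⟨rfl, h'⟩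
          exact hfk h'
      change MvPolynomial.rename _ (linForm (vertexRoot f i)) =
        _ * linForm (vertexRoot _ (Equiv.swap k k' i))
      simp only [vertexRoot, Equiv.Perm.mul_apply, hτ, hord]
      split_ifs <;> simp [rename_linForm_signedRoot]

/-! ### The polynomial `Z_d` -/

open Classical in
lemma ZD_eq_sum (hn : Odd n) (d : ℕ) :
    ZD n d = ∑ f ∈ Finset.univ.filter fun f : Equiv.Perm (Fin n) => IsNearPerfect f,
      (epsilonD (structureOf f) : MvPolynomial (Fin n) ℝ) * matchingPoly d f := by
  rw [ZD]
  symm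
  refine Finset.sum_nbij structureOf ?_ ?_ ?_ ?_
  · intro f hf
    have h := isTwoStructure_structureOf (Finset.mem_filter.1 hf).2
    exact Finset.mem_filter.2 ⟨Finset.mem_powerset.2 h.subset, h⟩
  · intro f hf g hg h
    exact structureOf_injOn (Finset.mem_filter.1 hf).2 (Finset.mem_filter.1 hg).2 h
  · intro φ hφ
    obtain ⟨f, hf, rfl⟩ := (Finset.mem_filter.1 hφ).2.exists_eq_structureOf hn
    exact ⟨f, Finset.mem_filter.2 ⟨Finset.mem_univ _, hf⟩, rfl⟩
  · intro f hf
    rw [taylorPolySet_eq_matchingPoly d (Finset.mem_filter.1 hf).2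
      (fun x => Finset.mem_inter), map_intCast]

lemma isHomogeneous_ZD (hn : Odd n) (d : ℕ) : (ZD n d).IsHomogeneous d := by
  rw [ZD_eq_sum hn]
  refine MvPolynomial.IsHomogeneous.sum _ _ _ fun f _ => ?_
  rw [← map_intCast (MvPolynomial.C : ℝ →+* MvPolynomial (Fin n) ℝ)]
  exact (isHomogeneous_matchingPoly d f).C_mul _

lemma flip_ZD (hn : Odd n) (d : ℕ) (k : Fin n) : flip k (ZD n d) = ZD n d := by
  classical
  rw [ZD_eq_sum hn, map_sum]
  refine Finset.sum_congr rfl fun f hf => ?_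
  rw [map_mul, map_intCast, flip_matchingPoly d (Finset.mem_filter.1 hf).2]

lemma rename_swap_succ_ZD (hn : Odd n) (d : ℕ) {k k' : Fin n} (hk : (k' : ℕ) = k + 1) :
    MvPolynomial.rename (Equiv.swap k k') (ZD n d) = -ZD n d := by
  classical
  have hτ : ∀ i, Equiv.swap k k' (Equiv.swap k k' i) = i := Equiv.swap_apply_self k k'
  have hinv : ∀ f : Equiv.Perm (Fin n),
      Equiv.swap k k' * (Equiv.swap k k' * f * Equiv.swap k k') * Equiv.swap k k' = f := fun f => by
    ext1 i
    simp [hτ]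
  rw [ZD_eq_sum hn, map_sum, ← Finset.sum_neg_distrib]
  refine Finset.sum_nbij' (fun f => Equiv.swap k k' * f * Equiv.swap k k')
    (fun f => Equiv.swap k k' * f * Equiv.swap k k') ?_ ?_ (fun f _ => hinv f)
    (fun f _ => hinv f) ?_
  · intro f hf
    exact Finset.mem_filter.2 ⟨Finset.mem_univ _, (Finset.mem_filter.1 hf).2.conj hτ⟩
  · intro f hf
    exact Finset.mem_filter.2 ⟨Finset.mem_univ _, (Finset.mem_filter.1 hf).2.conj hτ⟩
  · intro f hf
    rw [map_mul, map_intCast]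
    exact epsilonD_mul_rename_matchingPoly d (Finset.mem_filter.1 hf).2 hk

/-- `Z_d` is alternating, since the adjacent transpositions generate the symmetric group. -/
lemma rename_ZD (hn : Odd n) (d : ℕ) (σ : Equiv.Perm (Fin n)) :
    MvPolynomial.rename σ (ZD n d) = (Equiv.Perm.sign σ : ℤ) * ZD n d := by
  obtain ⟨m, rfl⟩ : ∃ m, n = m + 1 := ⟨n - 1, by have := hn.pos; omega⟩
  have hσ : σ ∈ Submonoid.closure
      (Set.range fun i : Fin m => Equiv.swap i.castSucc i.succ) := by
    rw [Equiv.Perm.mclosure_swap_castSucc_succ]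
    trivial
  induction hσ using Submonoid.closure_induction with
  | mem σ h =>
    obtain ⟨i, rfl⟩ := h
    rw [rename_swap_succ_ZD hn d (by simp), Equiv.Perm.sign_swap (Fin.castSucc_lt_succ).ne]
    simp
  | one =>
    rw [Equiv.Perm.coe_one, MvPolynomial.rename_id]
    simp
  | mul σ τ _ _ h h' =>
    rw [Equiv.Perm.coe_mul, ← MvPolynomial.rename_rename, h', map_mul, h, map_intCast,
      Equiv.Perm.sign_mul]
    push_cast
    ring

lemma coeff_flip (k : Fin n) (P : MvPolynomial (Fin n) ℝ) (μ : Fin n →₀ ℕ) :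
    (flip k P).coeff μ = (-1) ^ μ k * P.coeff μ := by
  induction P using MvPolynomial.induction_on' with
  | monomial ν a =>
    have h : flip k (MvPolynomial.monomial ν a) =
        MvPolynomial.monomial ν ((-1) ^ ν k * a) := by
      rw [flip, MvPolynomial.aeval_monomial, MvPolynomial.monomial_eq, Finsupp.prod_fintype _ _
        (by simp), Finsupp.prod_fintype _ _ (by simp)]
      have : ∀ j, (if j = k then -(MvPolynomial.X j : MvPolynomial (Fin n) ℝ)
          else MvPolynomial.X j) ^ ν j = (if j = k then (-1) ^ ν k else 1) *
          MvPolynomial.X j ^ ν j := fun j => by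
        split_ifs with h
        · rw [h, neg_pow]
        · rw [one_mul]
      simp only [this, Finset.prod_mul_distrib, Finset.prod_ite_eq', Finset.mem_univ, if_true,
        MvPolynomial.algebraMap_eq, map_mul, map_pow, map_neg, map_one]
      ring
    rw [h, MvPolynomial.coeff_monomial, MvPolynomial.coeff_monomial]
    split_ifs with h
    · rw [h]
    · rw [mul_zero]
  | add P Q hP hQ => rw [map_add, MvPolynomial.coeff_add, MvPolynomial.coeff_add, hP, hQ, mul_add]

lemma even_of_mem_support_ZD (hn : Odd n) (d : ℕ) {μ : Fin n →₀ ℕ} (hμ : μ ∈ (ZD n d).support)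
    (k : Fin n) : Even (μ k) := by
  by_contra hodd
  have h := coeff_flip k (ZD n d) μ
  rw [flip_ZD hn, (Nat.not_even_iff_odd.1 hodd).neg_one_pow] at h
  rw [MvPolynomial.mem_support_iff] at hμ
  exact hμ (by linarith)

/-- A polynomial whose exponents are all even is a polynomial in the squares of the variables. -/
lemma exists_eq_aeval_sq {P : MvPolynomial (Fin n) ℝ} (hP : ∀ μ ∈ P.support, ∀ i, Even (μ i)) :
    ∃ Q : MvPolynomial (Fin n) ℝ,
      P = MvPolynomial.aeval (fun i => (MvPolynomial.X i : MvPolynomial (Fin n) ℝ) ^ 2) Q := by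
  refine ⟨∑ μ ∈ P.support,
    MvPolynomial.monomial (μ.mapRange (· / 2) (Nat.zero_div 2)) (P.coeff μ), ?_⟩
  rw [map_sum]
  conv_lhs => rw [P.as_sum]
  refine Finset.sum_congr rfl fun μ hμ => ?_
  rw [MvPolynomial.aeval_monomial, MvPolynomial.monomial_eq, Finsupp.prod_fintype _ _ (by simp),
    Finsupp.prod_fintype _ _ (by simp), MvPolynomial.algebraMap_eq]
  congr 1
  refine Finset.prod_congr rfl fun i _ => ?_
  rw [Finsupp.mapRange_apply, ← pow_mul, Nat.two_mul_div_two_of_even (hP μ hμ i)]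

lemma not_forall_pos_of_mem_support_ZD (hn : Odd n) (d : ℕ) {μ : Fin n →₀ ℕ}
    (hμ : μ ∈ (ZD n d).support) : ¬ ∀ i, 0 < μ i := by
  classical
  intro hpos
  rw [MvPolynomial.mem_support_iff, ZD_eq_sum hn, MvPolynomial.coeff_sum] at hμ
  refine hμ (Finset.sum_eq_zero fun f hf => ?_)
  have hf := (Finset.mem_filter.1 hf).2
  obtain ⟨p, hp, -⟩ := hf.existsUnique_fixed
  rw [← map_intCast (MvPolynomial.C : ℝ →+* MvPolynomial (Fin n) ℝ), MvPolynomial.coeff_C_mul]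
  have hvars := MvPolynomial.mem_supported.1 (matchingPoly_mem_supported d hf hp)
  by_contra hne
  have hmem : p ∈ (matchingPoly d f).vars := (MvPolynomial.mem_vars_iff_mem_support p).2
    ⟨μ, MvPolynomial.mem_support_iff.2 (right_ne_zero_of_mul hne),
      Finsupp.mem_support_iff.2 (hpos p).ne'⟩
  exact hvars hmem rfl

lemma ne_of_mem_support_ZD (hn : Odd n) (d : ℕ) {μ : Fin n →₀ ℕ}
    (hμ : μ ∈ (ZD n d).support) {i j : Fin n} (hij : i ≠ j) : μ i ≠ μ j := by
  intro heq
  have h := MvPolynomial.coeff_rename_mapDomain _ (Equiv.swap i j).injective (ZD n d) μ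
  have hmap : Finsupp.mapDomain (Equiv.swap i j) μ = μ := by
    ext k
    rw [Finsupp.mapDomain_equiv_apply, Equiv.symm_swap, Equiv.swap_apply_def]
    split_ifs with h1 h2
    · rw [h1, heq]
    · rw [h2, heq]
    · rfl
  rw [hmap, rename_ZD hn, Equiv.Perm.sign_swap hij] at h
  simp only [Units.val_neg, Units.val_one, Int.cast_neg, Int.cast_one, neg_one_mul,
    MvPolynomial.coeff_neg] at h
  rw [MvPolynomial.mem_support_iff] at hμ
  exact hμ (by linarith)

lemma refl_e_apply (i : Fin n) (a : Space n) (j : Fin n) :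
    refl (e i) a j = if j = i then -a j else a j := by
  rw [refl, Submodule.reflection_orthogonal_apply, Submodule.reflection_singleton_apply]
  by_cases h : j = i
  · subst h
    simp [e, two_mul, EuclideanSpace.inner_single_left]
  · simp [e, h]

lemma eval_refl_eq_eval_flip (i : Fin n) (a : Space n) (P : MvPolynomial (Fin n) ℝ) :
    MvPolynomial.eval (fun j => refl (e i) a j) P =
      MvPolynomial.eval (fun j => a j) (flip i P) := by
  induction P using MvPolynomial.induction_on with
  | C a => simp [flip]
  | add P Q hP hQ => rw [map_add, map_add, map_add, hP, hQ]
  | mul_X P j hP =>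
    rw [map_mul, map_mul, map_mul, hP, MvPolynomial.eval_X, refl_e_apply, flip,
      MvPolynomial.aeval_X]
    split_ifs <;> simp

end

end Pizza

theorem lemma5p1 (n : ℕ) (hn : Odd n) (d : ℕ) :
    (Pizza.ZD n d).IsHomogeneous d ∧
    (∀ (i : Fin n) (a : Pizza.Space n),
      MvPolynomial.eval (fun j => Pizza.refl (Pizza.e i) a j) (Pizza.ZD n d) =
        MvPolynomial.eval (fun j => a j) (Pizza.ZD n d)) ∧
    (∃ Q : MvPolynomial (Fin n) ℝ,
      Pizza.ZD n d =
        MvPolynomial.aeval (fun i => (MvPolynomial.X i : MvPolynomial (Fin n) ℝ) ^ 2) Q) ∧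
    (∀ μ ∈ (Pizza.ZD n d).support, ¬ ∀ i, 0 < μ i) ∧
    (∀ μ ∈ (Pizza.ZD n d).support, ∀ i j, i ≠ j → μ i ≠ μ j) := by
  refine ⟨Pizza.isHomogeneous_ZD hn d, fun i a => ?_,
    Pizza.exists_eq_aeval_sq fun μ hμ i => Pizza.even_of_mem_support_ZD hn d hμ i,
    fun μ hμ => Pizza.not_forall_pos_of_mem_support_ZD hn d hμ,
    fun μ hμ i j hij => Pizza.ne_of_mem_support_ZD hn d hμ hij⟩
  rw [Pizza.eval_refl_eq_eval_flip, Pizza.flip_ZD hn]
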